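/- **Setting.** Let $N=2^n$ with $n\ge 1$, $\log=\log_2$, and let $x=(x_i)_{i\in\{0,1\}^n}$ be a table of bits. The *planar bucket-brigade QRAM* has $n$ address cells, a bus cell, and a binary tree of $N-1$ CSWAP routers on levels $0,\dots,n-1$. Each router consists of four cells (status $t$, input $in$, outputs $L,R$) in a T-shape on a square grid. The routers are placed along an H-tree: horizontal steps at even levels, vertical steps at odd levels, and distance $2^{\lfloor (n-j)/2\rfloor}$ between the centres of a level-$j$ router and its children. The cells are either qubits, with unused cells in $|0\rangle$, or have a third waiting state $|w\rangle$, in which unused cells and the status of inactive routers are kept, in which a router routes nothing, and which is fixed by $X$. **Query.** In the first half of the query the address items $\ell=0,\dots,n-1$ and then the bus (item $n$) are swapped one after the other into the root's input, at times $0,2,6,10,\dots$. An item that reaches level $j$ is routed in two time steps ($in\leftrightarrow L$ if $t=0$, then $in\leftrightarrow R$ if $t=1$). Between levels $j$ and $j+1$, in one time step, all routers of level $j$ perform long-range SWAPs of their outputs with the inputs of their children. Item $\ell<n$ is swapped into the status register at level $\ell$; the bus goes to an output of the last level. In one further time step the data are written by classically controlled $X$ gates at the memory locations (the outputs of the last level),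 and then the whole first half is run in reverse. **Noise.** In every time step, on the whole device, each local SWAP is faulty with probability $\varepsilon_s$, each CSWAP with probability $\varepsilon_{cs}$, and each cell on which no gate acts, as well as each memory cell being written, with probability $\varepsilon_I$, all independently. Each long-range SWAP uses three GHZ states of length $m$, the number of grid qubits on the straight line between its two cells (ends included). It is correct only if all these $3m$ qubits are free of errors, each of which has an error independently with probability $\varepsilon_Q$. Long-range SWAPs within the first $k$ levels $0,\dots,k-1$ are free of errors. A faulty operation is followed by an arbitrary quantum channel on the cells it acts on. All rates lie in $[0,1]$. **Infidelity.** For the input $\sum_i\alpha_i|i\rangle|0\rangle$ with all routers unused, the infidelity is $1-\langle\psi|\rho|\psi\rangle$, where $\psi=\sum_i\alpha_i|i\rangle|x_i\rangle$ and $\rho$ is the final state of the address and bus cells. **Claim.** There is an absolute constant $C>0$ such that for all $n\ge1$, $0\le k\le n$, all tables $x$, all rates and all choices of the channels, the infidelity is at most $$C\left(2^{-k/2}\log N\,\sqrt N\,\varepsilon_Q+\log N\,\varepsilon_s+\log^2 N\,\varepsilon_{cs}+\log^2 N\,\varepsilon_I\right),$$ both (a) for cells with a waiting state and every superposition $\sum_i|\alpha_i|^2=1$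 of addresses, and (b) for qubit cells and every single address $i$ (there the infidelity is the probability of failing the query). Moreover, there is an absolute constant $C'>0$ such that for $k=\log N$, when all four rates are at most $\varepsilon$, the infidelity in (a) and in (b) is at most $C'\log^2 N\,\varepsilon$. -/

import Mathlib

open scoped Matrix ComplexConjugate

noncomputable section

namespace QRAM

/-! ## Cells of the device -/

/-- The basis states of one physical cell.  `idle` is the state of an unused cell, `enc` encodes a
bit, `dir` is the direction in which a router with this status routes (`none`: it is inactive and
routes nothing, `some false`: to the left, `some true`: to the right), and `flip` is the `X` gate
on the encoded bit. -/
class CellModel (A : Type) where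
  idle : A
  enc : Bool → A
  dir : A → Option Bool
  flip : Equiv.Perm A

/-- Two-level cells (qubits); unused cells are in `|0⟩`. -/
instance qubitCell : CellModel Bool where
  idle := false
  enc := id
  dir := some
  flip := Equiv.boolNot

/-- Cells with an additional waiting state `|w⟩` (here `none`), in which unused cells and the
status of inactive routers are kept; a router in state `|w⟩` routes nothing and `X` fixes `|w⟩`. -/
instance waitingCell : CellModel (Option Bool) where
  idle := none
  enc := some
  dir := id
  flip := Equiv.optionCongr Equiv.boolNot

/-- The registers of a CSWAP router: the status `t`, the input `in`, and the outputs
`L = port false`, `R = port true`. -/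
inductive Site : Type
  | status
  | input
  | port (b : Bool)
  deriving DecidableEq, Fintype

/-- The routers of the tree over `2 ^ n` memory locations: a level `ℓ < n` and the first `ℓ` address
bits that lead to the router.  The root has level `0`. -/
abbrev Node (n : ℕ) : Type := Σ ℓ : Fin n, (Fin (ℓ : ℕ) → Bool)

/-- The child of router `v` in direction `b`, for `v` not on the last level. -/
def child {n : ℕ} (v : Node n) (b : Bool) (h : (v.1 : ℕ) + 1 < n) : Node n :=
  ⟨⟨(v.1 : ℕ) + 1, h⟩, fun j => if hj : (j : ℕ) < (v.1 : ℕ) then v.2 ⟨j, hj⟩ else b⟩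

/-- The memory address below output `b` of a router `v` on the last level. -/
def leafAddress {n : ℕ} (v : Node n) (b : Bool) : Fin n → Bool :=
  fun j => if hj : (j : ℕ) < (v.1 : ℕ) then v.2 ⟨j, hj⟩ else b

/-- All cells: the `n` address cells, the bus cell, and four cells for each router. -/
inductive Cell (n : ℕ) : Type
  | addr (ℓ : Fin n)
  | bus
  | router (v : Node n) (s : Site)
  deriving DecidableEq, Fintype

/-- Computational basis states of the whole device. -/
abbrev Config (n : ℕ) (A : Type) : Type := Cell n → A

/-! ## Planar H-tree layout -/

/-- The unit vector in direction `b` along the axis used at level `j`: horizontal at even levels,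
vertical at odd levels. -/
def step (j : ℕ) (b : Bool) : ℤ × ℤ :=
  let s : ℤ := if b then 1 else -1
  if Even j then (s, 0) else (0, s)

/-- The distance between the centres of a router of level `j` and of its children. -/
def spacing (n j : ℕ) : ℤ := 2 ^ ((n - j) / 2)

/-- The centre of a router (the position of its input register) on the grid; the root is at the
origin. -/
def centre {n : ℕ} (v : Node n) : ℤ × ℤ :=
  ∑ j : Fin (v.1 : ℕ), spacing n j • step j (v.2 j)

/-- T-shaped router: the outputs lie next to the input on the axis of the router's level, the
status lies next to the input on the perpendicular axis, facing away from the parent. -/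
def position {n : ℕ} (v : Node n) : Site → ℤ × ℤ
  | .input => centre v
  | .port b => centre v + step v.1 b
  | .status =>
      if h : 0 < (v.1 : ℕ) then
        centre v + step ((v.1 : ℕ) - 1) (v.2 ⟨(v.1 : ℕ) - 1, Nat.sub_lt h Nat.one_pos⟩)
      else centre v + (0, -1)

/-- The number of grid qubits on the straight line from output `b` of `v` to the input of the
child in direction `b` (end points included); this is the length of the GHZ states used there. -/
def linkLength {n : ℕ} (v : Node n) (b : Bool) (h : (v.1 : ℕ) + 1 < n) : ℕ :=
  let p := position v (.port b)
  let q := position (child v b h) .input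
  (p.1 - q.1).natAbs + (p.2 - q.2).natAbs + 1

/-! ## Gates -/

/-- The kinds of operations.  `longRange ℓ m` is a long-range SWAP between a router and its child
of level `ℓ` along a line of `m` grid qubits. -/
inductive OpKind : Type
  | idle
  | swap
  | cswap
  | longRange (ℓ m : ℕ)

/-- An operation: the cells on which it acts, its action on basis states, and its kind. -/
structure Gate (n : ℕ) (A : Type) where
  support : Finset (Cell n)
  act : Equiv.Perm (Config n A)
  kind : OpKind

section Gates

variable {n : ℕ} {A : Type}

/-- Exchange the contents of two cells. -/
def swapCells (p q : Cell n) : Equiv.Perm (Config n A) :=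
  (Equiv.swap p q).arrowCongr (Equiv.refl A)

def idleGate (q : Cell n) : Gate n A := ⟨{q}, Equiv.refl _, .idle⟩

def swapGate (p q : Cell n) : Gate n A := ⟨{p, q}, swapCells p q, .swap⟩

def longRangeGate (v : Node n) (b : Bool) (h : (v.1 : ℕ) + 1 < n) : Gate n A :=
  ⟨{Cell.router v (.port b), Cell.router (child v b h) .input},
    swapCells (Cell.router v (.port b)) (Cell.router (child v b h) .input),
    .longRange ((v.1 : ℕ) + 1) (linkLength v b h)⟩

variable [CellModel A]

/-- On basis states: exchange input and output `b` of `v` if the status of `v` is `b`. -/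
def cswapFun (v : Node n) (b : Bool) (c : Config n A) : Config n A :=
  if CellModel.dir (c (Cell.router v .status)) = some b then
    swapCells (Cell.router v .input) (Cell.router v (.port b)) c
  else c

theorem cswapFun_involutive (v : Node n) (b : Bool) :
    Function.Involutive (cswapFun (A := A) v b) := by
  intro c
  have key : swapCells (Cell.router v .input) (Cell.router v (.port b)) c (Cell.router v .status)
      = c (Cell.router v .status) := by
    simp [swapCells, Equiv.swap_apply_def]
  unfold cswapFun
  split_ifs with h₁ h₂
  · funext q
    simp [swapCells]
  · rw [key] at h₂
    exact absurd h₁ h₂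
  · rfl

/-- The controlled SWAP of input and output `b`, controlled on status `b`. -/
def cswapGate (v : Node n) (b : Bool) : Gate n A :=
  ⟨{Cell.router v .status, Cell.router v .input, Cell.router v (.port b)},
    (cswapFun_involutive v b).toPerm, .cswap⟩

/-- The classically controlled `X` gate that writes the datum `x_i` at the memory location `i` below
output `b` of `v`.  No gate error type is assigned to it; the cell is charged as if it idled. -/
def writeGate (x : (Fin n → Bool) → Bool) (v : Node n) (b : Bool) : Gate n A :=
  ⟨{Cell.router v (.port b)},
    Equiv.piCongrRight fun q =>
      if q = Cell.router v (.port b) ∧ x (leafAddress v b) = true then CellModel.flip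
      else Equiv.refl A,
    .idle⟩

end Gates

/-! ## The query circuit -/

section Circuit

variable (n : ℕ) (A : Type) [CellModel A]

/-- The routers of level `j`. -/
def levelNodes (j : ℕ) : List (Node n) :=
  (Finset.univ.filter fun v : Node n => (v.1 : ℕ) = j).toList

/-- SWAP of the `ℓ`-th item with the input of the root; the items are the address cells
`ℓ < n` and the bus, which is item `n`. -/
def loadOps (ℓ : ℕ) : List (Gate n A) :=
  (levelNodes n 0).map fun v =>
    swapGate (if h : ℓ < n then Cell.addr ⟨ℓ, h⟩ else Cell.bus) (Cell.router v .input)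

/-- All routers of level `j` swap input and output `b` if their status is `b`. -/
def routeOps (j : ℕ) (b : Bool) : List (Gate n A) :=
  (levelNodes n j).map fun v => cswapGate v b

/-- All routers of level `j` exchange both outputs with the inputs of their children. -/
def linkOps (j : ℕ) : List (Gate n A) :=
  (levelNodes n j).flatMap fun v =>
    if h : (v.1 : ℕ) + 1 < n then [longRangeGate v false h, longRangeGate v true h] else []

/-- All routers of level `j` store their input as status. -/
def setOps (j : ℕ) : List (Gate n A) :=
  (levelNodes n j).map fun v => swapGate (Cell.router v .input) (Cell.router v .status)

/-- The operations that concern item `ℓ`, `s` time steps after it has been loaded: at step `0` it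
is loaded, at steps `3 j + 1`, `3 j + 2`, `3 j + 3` it is routed by level `j < ℓ` and moved on to
level `j + 1`, and at step `3 ℓ + 1` an address item is stored as status at level `ℓ`.  The bus
(item `n`) is not stored, but stays in the outputs of the last level. -/
def itemOps (ℓ s : ℕ) : List (Gate n A) :=
  if s = 0 then loadOps n A ℓ
  else if s ≤ 3 * ℓ then
    (if s % 3 = 1 then routeOps n A ((s - 1) / 3) false
     else if s % 3 = 2 then routeOps n A ((s - 1) / 3) true
     else linkOps n A ((s - 1) / 3))
  else if s = 3 * ℓ + 1 ∧ ℓ < n then setOps n A ℓ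
  else []

/-- The time step at which item `ℓ` is loaded: `0, 2, 6, 10, 14, …`, so that several items travel
through the tree at the same time. -/
def startTime (ℓ : ℕ) : ℕ := 4 * ℓ - 2

/-- Operations at time step `s` of the first half of the query (setting the routers and routing the
bus in). -/
def inLayer (s : ℕ) : List (Gate n A) :=
  (List.range (n + 1)).flatMap fun ℓ =>
    if startTime ℓ ≤ s then itemOps n A ℓ (s - startTime ℓ) else []

/-- The time steps of the first half: the bus is loaded at `4 n - 2` and routed in
`3 (n - 1) + 2` further steps. -/
def inLayers : List (List (Gate n A)) :=
  (List.range (7 * n - 2)).map (inLayer n A)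

/-- All data are written at the memory locations. -/
def writeLayer (x : (Fin n → Bool) → Bool) : List (Gate n A) :=
  (levelNodes n (n - 1)).flatMap fun v => [writeGate x v false, writeGate x v true]

/-- The full query: route in, write the data, and the same circuit in reverse. -/
def layers (x : (Fin n → Bool) → Bool) : List (List (Gate n A)) :=
  inLayers n A ++ [writeLayer n A x] ++ (inLayers n A).reverse

/-- Add an idle operation on every cell of the device that is not used in the time step. -/
def withIdle (L : List (Gate n A)) : List (Gate n A) :=
  L ++ (Finset.univ.filter fun q : Cell n => ∀ g ∈ L, q ∉ g.support).toList.map idleGate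

/-- The sequence of all operations of the query. -/
def operations (x : (Fin n → Bool) → Bool) : List (Gate n A) :=
  (layers n A x).flatMap (withIdle n A)

end Circuit

/-! ## Noise -/

/-- The probabilities of an idling error (per cell and time step), of an error on a single qubit of
a GHZ state, of a SWAP error and of a CSWAP error. -/
structure ErrorRates where
  εI : ℝ
  εQ : ℝ
  εs : ℝ
  εcs : ℝ

def ErrorRates.Valid (ε : ErrorRates) : Prop :=
  (0 ≤ ε.εI ∧ ε.εI ≤ 1) ∧ (0 ≤ ε.εQ ∧ ε.εQ ≤ 1) ∧ (0 ≤ ε.εs ∧ ε.εs ≤ 1) ∧ (0 ≤ ε.εcs ∧ ε.εcs ≤ 1)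

/-- The probability that an operation is faulty.  A long-range SWAP within the first `k` levels
(levels `0, …, k - 1`) is free of errors.  Any other one consists of three long-range CNOTs, each
using up a GHZ state of `m` qubits, and it is correct only if each of these `3 m` qubits is free of
errors, which happens independently with probability `1 - ε_Q` for each. -/
def faultProb (k : ℕ) (ε : ErrorRates) : OpKind → ℝ
  | .idle => ε.εI
  | .swap => ε.εs
  | .cswap => ε.εcs
  | .longRange ℓ m => if ℓ < k then 0 else 1 - (1 - ε.εQ) ^ (3 * m)

section Noise

variable {n : ℕ} {A : Type} [Fintype A] [DecidableEq A]

/-- An arbitrary quantum channel on the cells in `S`, in Kraus form. -/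
structure Channel (A : Type) [Fintype A] [DecidableEq A] {n : ℕ} (S : Finset (Cell n)) where
  size : ℕ
  kraus : Fin size → Matrix (S → A) (S → A) ℂ
  complete : ∑ a, (kraus a)ᴴ * kraus a = 1

/-- The operator on the whole device that acts as `K` on `S` and trivially elsewhere. -/
def extend (S : Finset (Cell n)) (K : Matrix (S → A) (S → A) ℂ) :
    Matrix (Config n A) (Config n A) ℂ :=
  Matrix.of fun c c' =>
    if ∀ q, q ∉ S → c q = c' q then K (fun q => c q) (fun q => c' q) else 0

def Channel.apply {S : Finset (Cell n)} (E : Channel A S)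
    (ρ : Matrix (Config n A) (Config n A) ℂ) : Matrix (Config n A) (Config n A) ℂ :=
  ∑ a, extend S (E.kraus a) * ρ * (extend S (E.kraus a))ᴴ

/-- What a fault does: the `j`-th operation, if faulty, is followed by the given channel on the
cells it acts on. -/
abbrev FaultModel (n : ℕ) (A : Type) [Fintype A] [DecidableEq A] : Type :=
  ℕ → (S : Finset (Cell n)) → Channel A S

/-- One noisy operation: the ideal unitary, followed with probability `p` by the channel `E`. -/
def noisyOp (p : ℝ) (g : Gate n A) (E : Channel A g.support)
    (ρ : Matrix (Config n A) (Config n A) ℂ) : Matrix (Config n A) (Config n A) ℂ :=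
  let σ := ρ.submatrix g.act.symm g.act.symm
  ((1 - p : ℝ) : ℂ) • σ + (p : ℂ) • E.apply σ

variable [CellModel A]

/-- The basis state with address `i` and bus value `b` and the routers in the configuration `r`. -/
def assemble (i : Fin n → Bool) (b : Bool) (r : Node n × Site → A) : Config n A
  | .addr ℓ => CellModel.enc (i ℓ)
  | .bus => CellModel.enc b
  | .router v s => r (v, s)

/-- The initial pure state `∑ i, α_i |i⟩ |0⟩` with all routers unused. -/
def initialVec (α : (Fin n → Bool) → ℂ) : Config n A → ℂ :=
  fun c => ∑ i, if c = assemble i false (fun _ => CellModel.idle) then α i else 0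

def initialState (α : (Fin n → Bool) → ℂ) : Matrix (Config n A) (Config n A) ℂ :=
  Matrix.vecMulVec (initialVec α) (star (initialVec α))

/-- The state of the device at the end of the noisy query. -/
def finalState (k : ℕ) (x : (Fin n → Bool) → Bool) (ε : ErrorRates) (E : FaultModel n A)
    (α : (Fin n → Bool) → ℂ) : Matrix (Config n A) (Config n A) ℂ :=
  (operations n A x).zipIdx.foldl
    (fun ρ g => noisyOp (faultProb k ε g.1.kind) g.1 (E g.2 g.1.support) ρ) (initialState α)

/-- `1 - ⟨ψ| ρ |ψ⟩` for `ψ = ∑ i, α_i |i⟩ |x_i⟩` and the final state `ρ` of the address and bus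
cells, that is, after tracing out all routers. -/
def infidelity (k : ℕ) (x : (Fin n → Bool) → Bool) (ε : ErrorRates) (E : FaultModel n A)
    (α : (Fin n → Bool) → ℂ) : ℝ :=
  1 - (∑ i, ∑ j, ∑ r : Node n × Site → A,
    conj (α i) * finalState k x ε E α (assemble i (x i) r) (assemble j (x j) r) * α j).re

end Noise

/-- The scaling `2^{-k/2} log N √N ε_Q + log N ε_s + log² N ε_cs + log² N ε_I`, `log = log₂`. -/
def errorScale (k : ℕ) (N : ℝ) (ε : ErrorRates) : ℝ :=
  (2 : ℝ) ^ (-(k : ℝ) / 2) * Real.logb 2 N * Real.sqrt N * ε.εQ + Real.logb 2 N * ε.εs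
    + Real.logb 2 N ^ 2 * ε.εcs + Real.logb 2 N ^ 2 * ε.εI

end QRAM

end

/-! The noise is expanded over fault patterns: each operation is faulty or not, and the final state
is a mixture over all choices. For a fixed pattern let `G` be the set of addresses (with nonzero
amplitude) such that no faulty operation touches a router on their path, an address cell or the bus.
The point is that errors elsewhere in the tree cannot reach these paths.

To make this precise, let `D = untracked G` be the cells that carry no item of any query in `G`.
Faults act inside `D`. In every branch `i ∈ G` the ideal gates never carry contents across the
boundary of `D` (`Separates`, `separates_cswapGate`): both ends of a long-range SWAP are tracked for
the same addresses, and a CSWAP that could connect an input outside `D` with an output inside `D` is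
switched off by its status. The last point needs the waiting state when `G` has several elements: in
branch `i`, a router on the path of another `j ∈ G` is inactive and must route nothing. An idle
qubit status would route to the left, so qubits are treated for one address only.

Consequently each Kraus history sends branch `i ∈ G` to the ideal basis state off `D` times a vector
on `D` that does not depend on `i` (`exists_kraus_history`). With waiting states the routers off `D`
all return to idle, so address and bus decouple from a common router state, and the infidelity is at
most four times the weight of the addresses outside `G` (`infidelity_kraus_le`). Averaging over
patterns, a union bound gives four times the mean, over addresses, of the total fault probability of
the operations near the path (`infidelity_le_sum_touches`).

It remains to count near one path. There are `O(n)` cells over `O(n)` time steps, which gives the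
idling term. Each of the `n + 1` items meets `O(n)` CSWAPs, `O(1)` local SWAPs and two links per
level. The link at level `j` has length `2 ^ ((n - j) / 2)`, so the noisy links form a geometric
series dominated by the first noisy level (`sum_sqrt_two_pow_le`). -/

noncomputable section

namespace QRAM

set_option linter.unusedSectionVars false

/-! ### Local operators and basis permutations as matrices on the whole device. -/

section Operators

variable {n : ℕ} {A : Type}

/-- The configuration that agrees with `s` on `S` and with `d` elsewhere. -/
def glue (S : Finset (Cell n)) (d : Config n A) (s : S → A) : Config n A :=
  fun q => if h : q ∈ S then s ⟨q, h⟩ else d q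

theorem glue_of_mem {S : Finset (Cell n)} (d : Config n A) (s : S → A) (q : S) :
    glue S d s q = s q := by
  simp [glue]

theorem glue_of_notMem {S : Finset (Cell n)} (d : Config n A) (s : S → A) {q : Cell n}
    (h : q ∉ S) : glue S d s q = d q := by
  simp [glue, h]

variable [Fintype A] [DecidableEq A]

/-- Row `d` of the extended operator is supported on configurations that agree with `d` off `S`, and
these are parametrised by their restriction to `S`. Both `extend_mul` and `splits_extend` rest on
this reindexing. -/
theorem extend_mulVec (S : Finset (Cell n)) (K : Matrix (S → A) (S → A) ℂ)
    (v : Config n A → ℂ) (d : Config n A) :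
    (extend S K *ᵥ v) d = ∑ s : S → A, K (fun q => d q) s * v (glue S d s) := by
  symm
  rw [Matrix.mulVec, dotProduct]
  refine Finset.sum_of_injOn (glue S d) ?_ (fun _ _ => by simp) ?_ ?_
  · intro s _ s' _ h
    funext q
    rw [← glue_of_mem d s q, ← glue_of_mem d s' q, h]
  · intro c _ hc
    rw [extend, Matrix.of_apply, if_neg, zero_mul]
    intro h
    refine hc ⟨fun q => c q, by simp, ?_⟩
    funext q
    by_cases hq : q ∈ S
    · simp [glue, hq]
    · simp [glue, hq, h q hq]
  · intro s _
    rw [extend, Matrix.of_apply, if_pos]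
    · congr 2
      funext q
      exact (glue_of_mem d s q).symm
    · intro q hq
      exact (glue_of_notMem d s hq).symm

theorem extend_mul (S : Finset (Cell n)) (K L : Matrix (S → A) (S → A) ℂ) :
    extend S K * extend S L = extend S (K * L) := by
  ext d d'
  have h : (extend S K * extend S L) d d' = (extend S K *ᵥ fun c => extend S L c d') d := rfl
  rw [h, extend_mulVec]
  simp only [extend, Matrix.of_apply]
  have key : ∀ s : S → A, (∀ q, q ∉ S → glue S d s q = d' q) ↔ (∀ q, q ∉ S → d q = d' q) := by
    intro s
    refine forall₂_congr fun q hq => ?_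
    rw [glue_of_notMem d s hq]
  simp only [key, glue_of_mem]
  split_ifs
  · rfl
  · simp

theorem extend_one (S : Finset (Cell n)) :
    extend S (1 : Matrix (S → A) (S → A) ℂ) = 1 := by
  ext d d'
  simp only [extend, Matrix.of_apply, Matrix.one_apply]
  by_cases h : d = d'
  · simp [h]
  · rw [if_neg h]
    split_ifs with h₁ h₂
    · refine absurd (funext fun q => ?_) h
      by_cases hq : q ∈ S
      · exact congrFun h₂ ⟨q, hq⟩
      · exact h₁ q hq
    · rfl
    · rfl

theorem extend_conjTranspose (S : Finset (Cell n)) (K : Matrix (S → A) (S → A) ℂ) :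
    (extend S K)ᴴ = extend S Kᴴ := by
  ext d d'
  simp only [extend, Matrix.of_apply, Matrix.conjTranspose_apply]
  have : (∀ q, q ∉ S → d' q = d q) ↔ (∀ q, q ∉ S → d q = d' q) :=
    forall₂_congr fun q _ => eq_comm
  simp only [this]
  split_ifs <;> simp

theorem extend_sum {ι : Type*} [Fintype ι] (S : Finset (Cell n))
    (K : ι → Matrix (S → A) (S → A) ℂ) :
    ∑ a, extend S (K a) = extend S (∑ a, K a) := by
  ext d d'
  simp only [extend, Matrix.sum_apply, Matrix.of_apply]
  split_ifs <;> simp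

theorem Channel.sum_extend {S : Finset (Cell n)} (E : Channel A S) :
    ∑ a, (extend S (E.kraus a))ᴴ * extend S (E.kraus a) = 1 := by
  simp only [extend_conjTranspose, extend_mul, extend_sum, E.complete, extend_one]

/-- The unitary matrix that permutes the basis states. -/
def permMatrix (g : Equiv.Perm (Config n A)) : Matrix (Config n A) (Config n A) ℂ :=
  (1 : Matrix (Config n A) (Config n A) ℂ).submatrix g.symm id

theorem permMatrix_mulVec (g : Equiv.Perm (Config n A)) (v : Config n A → ℂ) (d : Config n A) :
    (permMatrix g *ᵥ v) d = v (g.symm d) := by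
  simp [permMatrix, Matrix.mulVec, dotProduct, Matrix.one_apply]

theorem permMatrix_conj (g : Equiv.Perm (Config n A)) (ρ : Matrix (Config n A) (Config n A) ℂ) :
    permMatrix g * ρ * (permMatrix g)ᴴ = ρ.submatrix g.symm g.symm := by
  ext d d'
  simp [permMatrix, Matrix.mul_apply, Matrix.one_apply, apply_ite]

theorem permMatrix_unitary (g : Equiv.Perm (Config n A)) :
    (permMatrix g)ᴴ * permMatrix g = 1 := by
  ext d d'
  simp [permMatrix, Matrix.mul_apply, Matrix.one_apply, apply_ite, Equiv.symm_apply_eq]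

end Operators

/-! ### Norms under trace preserving Kraus families. -/

section Kraus

variable {X : Type*} [Fintype X] [DecidableEq X]

/-- The squared norm of a vector. -/
def normSqVec (v : X → ℂ) : ℝ := ∑ c, ‖v c‖ ^ 2

theorem star_dotProduct_self (v : X → ℂ) : star v ⬝ᵥ v = (normSqVec v : ℂ) := by
  simp only [normSqVec, dotProduct, Pi.star_apply, Complex.ofReal_sum]
  refine Finset.sum_congr rfl fun c _ => ?_
  rw [Complex.star_def, Complex.conj_mul', Complex.ofReal_pow]

/-- A trace preserving family of Kraus operators preserves the total squared norm. -/
theorem sum_normSqVec_mulVec {ι : Type*} [Fintype ι] (T : ι → Matrix X X ℂ)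
    (hT : ∑ a, (T a)ᴴ * T a = 1) (v : X → ℂ) :
    ∑ a, normSqVec (T a *ᵥ v) = normSqVec v := by
  have h : ∀ a, (normSqVec (T a *ᵥ v) : ℂ) = star v ⬝ᵥ (((T a)ᴴ * T a) *ᵥ v) := by
    intro a
    rw [← star_dotProduct_self, Matrix.star_mulVec, ← Matrix.dotProduct_mulVec,
      Matrix.mulVec_mulVec]
  have h2 : ((∑ a, normSqVec (T a *ᵥ v) : ℝ) : ℂ) = (normSqVec v : ℂ) := by
    rw [Complex.ofReal_sum, Finset.sum_congr rfl fun a _ => h a, ← dotProduct_sum,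
      ← Matrix.sum_mulVec, hT, Matrix.one_mulVec, star_dotProduct_self]
  exact_mod_cast h2

end Kraus

/-- The laws of a cell model that the query relies on. -/
class LawfulCell (A : Type) [CellModel A] : Prop where
  dir_enc : ∀ b, CellModel.dir (CellModel.enc b : A) = some b
  flip_enc : ∀ b, CellModel.flip (CellModel.enc b : A) = CellModel.enc !b

instance : LawfulCell Bool := ⟨fun _ => rfl, fun b => by cases b <;> rfl⟩

instance : LawfulCell (Option Bool) := ⟨fun _ => rfl, fun b => by cases b <;> rfl⟩

/-! ### From the Kraus branches of good addresses to the infidelity. -/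

section Infidelity

variable {n : ℕ} {A : Type} [Fintype A] [DecidableEq A] [CellModel A] [LawfulCell A]

theorem enc_injective : Function.Injective (CellModel.enc : Bool → A) := by
  intro a b h
  have := congrArg (CellModel.dir (A := A)) h
  simpa [LawfulCell.dir_enc] using this

theorem assemble_injective (x : (Fin n → Bool) → Bool) :
    Function.Injective fun p : (Fin n → Bool) × (Node n × Site → A) =>
      assemble p.1 (x p.1) p.2 := by
  rintro ⟨i, r⟩ ⟨j, s⟩ h
  have h₁ : i = j := funext fun ℓ => enc_injective (A := A) (congrFun h (Cell.addr ℓ))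
  have h₂ : r = s := funext fun q => congrFun h (Cell.router q.1 q.2)
  rw [h₁, h₂]

theorem sum_assemble_le_normSqVec (x : (Fin n → Bool) → Bool) (v : Config n A → ℂ) :
    ∑ r : Node n × Site → A, ∑ i, ‖v (assemble i (x i) r)‖ ^ 2 ≤ normSqVec v := by
  rw [Finset.sum_comm, ← Fintype.sum_prod_type'
    (f := fun i (r : Node n × Site → A) => ‖v (assemble i (x i) r)‖ ^ 2)]
  rw [← Finset.sum_image (f := fun d => ‖v d‖ ^ 2) ((assemble_injective x).injOn)]
  exact Finset.sum_le_sum_of_subset_of_nonneg (Finset.subset_univ _) fun _ _ _ => by positivity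

theorem normSqVec_eq_sum_assemble (x : (Fin n → Bool) → Bool) (v : Config n A → ℂ)
    (hv : ∀ d, (∀ i r, d ≠ assemble i (x i) r) → v d = 0) :
    normSqVec v = ∑ r : Node n × Site → A, ∑ i, ‖v (assemble i (x i) r)‖ ^ 2 := by
  rw [Finset.sum_comm, ← Fintype.sum_prod_type'
    (f := fun i (r : Node n × Site → A) => ‖v (assemble i (x i) r)‖ ^ 2)]
  rw [← Finset.sum_image (f := fun d => ‖v d‖ ^ 2) ((assemble_injective x).injOn)]
  refine (Finset.sum_subset (Finset.subset_univ _) fun d _ hd => ?_).symm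
  rw [hv d, norm_zero, zero_pow two_ne_zero]
  rintro i r rfl
  exact hd (Finset.mem_image_of_mem _ (Finset.mem_univ (i, r)))

/-- The component `⟨ψ, r | v⟩` of `v`, where `ψ = ∑ i, α_i |i⟩ |x_i⟩`. -/
def overlap (x : (Fin n → Bool) → Bool) (α : (Fin n → Bool) → ℂ) (v : Config n A → ℂ)
    (r : Node n × Site → A) : ℂ :=
  ∑ i, conj (α i) * v (assemble i (x i) r)

/-- The squared norm of the part of `v` that is orthogonal to `ψ = ∑ i, α_i |i⟩ |x_i⟩`. -/
def defect (x : (Fin n → Bool) → Bool) (α : (Fin n → Bool) → ℂ) (v : Config n A → ℂ) : ℝ :=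
  normSqVec v - ∑ r, ‖overlap x α v r‖ ^ 2

theorem defect_le_normSqVec (x : (Fin n → Bool) → Bool) (α : (Fin n → Bool) → ℂ)
    (v : Config n A → ℂ) : defect x α v ≤ normSqVec v :=
  sub_le_self _ (Finset.sum_nonneg fun _ _ => by positivity)

/-- Cauchy–Schwarz for each router configuration `r`, using that `α` is a unit vector. -/
theorem defect_nonneg (x : (Fin n → Bool) → Bool) {α : (Fin n → Bool) → ℂ}
    (hα : ∑ i, ‖α i‖ ^ 2 = 1) (v : Config n A → ℂ) : 0 ≤ defect x α v := by
  refine sub_nonneg.2 (le_trans (Finset.sum_le_sum fun r _ => ?_) (sum_assemble_le_normSqVec x v))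
  calc ‖overlap x α v r‖ ^ 2 ≤ (∑ i, ‖α i‖ * ‖v (assemble i (x i) r)‖) ^ 2 := by
        gcongr
        refine (norm_sum_le _ _).trans (le_of_eq (Finset.sum_congr rfl fun i _ => ?_))
        rw [norm_mul, RCLike.norm_conj]
    _ ≤ (∑ i, ‖α i‖ ^ 2) * ∑ i, ‖v (assemble i (x i) r)‖ ^ 2 :=
        Finset.sum_mul_sq_le_sq_mul_sq _ _ _
    _ = _ := by rw [hα, one_mul]

theorem parallelogram_sq (a b : ℂ) : ‖a + b‖ ^ 2 + ‖a - b‖ ^ 2 = 2 * ‖a‖ ^ 2 + 2 * ‖b‖ ^ 2 := by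
  have := parallelogram_law_with_norm ℝ a b
  nlinarith [this]

/-- Norm and overlap each obey the parallelogram law, hence so does the defect; the nonnegative term
for `u - v` is dropped. -/
theorem defect_add_le (x : (Fin n → Bool) → Bool) {α : (Fin n → Bool) → ℂ}
    (hα : ∑ i, ‖α i‖ ^ 2 = 1) (u v : Config n A → ℂ) :
    defect x α (u + v) ≤ 2 * defect x α u + 2 * defect x α v := by
  have hadd : ∀ r, overlap x α (u + v) r = overlap x α u r + overlap x α v r := fun r => by
    simp [overlap, mul_add, Finset.sum_add_distrib]
  have hsub : ∀ r, overlap x α (u - v) r = overlap x α u r - overlap x α v r := fun r => by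
    simp [overlap, mul_sub, Finset.sum_sub_distrib]
  have h : defect x α (u + v) + defect x α (u - v) = 2 * defect x α u + 2 * defect x α v := by
    have h₁ : normSqVec (u + v) + normSqVec (u - v) = 2 * normSqVec u + 2 * normSqVec v := by
      simp only [normSqVec, Finset.mul_sum, ← Finset.sum_add_distrib]
      exact Finset.sum_congr rfl fun c _ => parallelogram_sq _ _
    have h₂ : ∑ r, ‖overlap x α (u + v) r‖ ^ 2 + ∑ r, ‖overlap x α (u - v) r‖ ^ 2
        = 2 * ∑ r, ‖overlap x α u r‖ ^ 2 + 2 * ∑ r, ‖overlap x α v r‖ ^ 2 := by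
      simp only [Finset.mul_sum, ← Finset.sum_add_distrib, hadd, hsub]
      exact Finset.sum_congr rfl fun c _ => parallelogram_sq _ _
    unfold defect
    linarith
  linarith [defect_nonneg x hα (u - v)]

/-- The fidelity `⟨ψ| ρ |ψ⟩`, where `ψ = ∑ i, α_i |i⟩ |x_i⟩` and the routers are traced out. -/
def fidelity (x : (Fin n → Bool) → Bool) (α : (Fin n → Bool) → ℂ)
    (ρ : Matrix (Config n A) (Config n A) ℂ) : ℝ :=
  (∑ i, ∑ j, ∑ r : Node n × Site → A,
    conj (α i) * ρ (assemble i (x i) r) (assemble j (x j) r) * α j).re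

theorem fidelity_add (x : (Fin n → Bool) → Bool) (α : (Fin n → Bool) → ℂ)
    (ρ σ : Matrix (Config n A) (Config n A) ℂ) :
    fidelity x α (ρ + σ) = fidelity x α ρ + fidelity x α σ := by
  simp [fidelity, mul_add, add_mul, Finset.sum_add_distrib]

theorem fidelity_smul (x : (Fin n → Bool) → Bool) (α : (Fin n → Bool) → ℂ) (p : ℝ)
    (ρ : Matrix (Config n A) (Config n A) ℂ) :
    fidelity x α ((p : ℂ) • ρ) = p * fidelity x α ρ := by
  have h : (∑ i, ∑ j, ∑ r : Node n × Site → A,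
      conj (α i) * ((p : ℂ) • ρ) (assemble i (x i) r) (assemble j (x j) r) * α j)
      = p * ∑ i, ∑ j, ∑ r : Node n × Site → A,
        conj (α i) * ρ (assemble i (x i) r) (assemble j (x j) r) * α j := by
    simp only [Finset.mul_sum]
    refine Finset.sum_congr rfl fun i _ => Finset.sum_congr rfl fun j _ =>
      Finset.sum_congr rfl fun r _ => ?_
    rw [Matrix.smul_apply, smul_eq_mul]
    ring
  unfold fidelity
  rw [h, Complex.re_ofReal_mul]

theorem fidelity_sum {ι : Type*} [Fintype ι] (x : (Fin n → Bool) → Bool) (α : (Fin n → Bool) → ℂ)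
    (ρ : ι → Matrix (Config n A) (Config n A) ℂ) :
    fidelity x α (∑ a, ρ a) = ∑ a, fidelity x α (ρ a) := by
  let f : Matrix (Config n A) (Config n A) ℂ →+ ℝ :=
    { toFun := fidelity x α
      map_zero' := by simp [fidelity]
      map_add' := fidelity_add x α }
  exact map_sum f ρ Finset.univ

theorem fidelity_vecMulVec (x : (Fin n → Bool) → Bool) (α : (Fin n → Bool) → ℂ)
    (v : Config n A → ℂ) :
    fidelity x α (Matrix.vecMulVec v (star v)) = ∑ r, ‖overlap x α v r‖ ^ 2 := by
  have h : ∀ r, ((‖overlap x α v r‖ ^ 2 : ℝ) : ℂ)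
      = ∑ i, ∑ j, conj (α i) * Matrix.vecMulVec v (star v) (assemble i (x i) r)
          (assemble j (x j) r) * α j := by
    intro r
    rw [Complex.ofReal_pow, ← Complex.mul_conj', overlap, map_sum, Finset.sum_mul_sum]
    refine Finset.sum_congr rfl fun i _ => Finset.sum_congr rfl fun j _ => ?_
    simp only [map_mul, Complex.conj_conj, Matrix.vecMulVec_apply, Pi.star_apply,
      Complex.star_def]
    ring
  rw [fidelity, ← Complex.ofReal_re (∑ r, ‖overlap x α v r‖ ^ 2), Complex.ofReal_sum,
    Finset.sum_congr rfl fun r _ => h r]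
  congr 1
  symm
  rw [Finset.sum_comm]
  exact Finset.sum_congr rfl fun i _ => Finset.sum_comm

/-- The initial basis state with address `i`. -/
def initialBasis (A : Type) [DecidableEq A] [CellModel A] (i : Fin n → Bool) : Config n A → ℂ :=
  Pi.single (assemble i false fun _ => CellModel.idle) 1

theorem initialVec_eq (α : (Fin n → Bool) → ℂ) :
    initialVec (A := A) α = ∑ i, α i • initialBasis A i := by
  funext c
  simp [initialVec, initialBasis, Pi.single_apply]

theorem normSqVec_initialBasis (i : Fin n → Bool) : normSqVec (initialBasis A i) = 1 := by
  simp [normSqVec, initialBasis, Pi.single_apply, apply_ite]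

theorem normSqVec_sum_initialBasis (B : Finset (Fin n → Bool)) (α : (Fin n → Bool) → ℂ) :
    normSqVec (∑ i ∈ B, α i • initialBasis A i) = ∑ i ∈ B, ‖α i‖ ^ 2 := by
  rw [normSqVec_eq_sum_assemble (fun _ => false)]
  · have h : ∀ i (r : Node n × Site → A),
        (∑ j ∈ B, α j • initialBasis A j) (assemble i false r)
          = if r = (fun _ => CellModel.idle) ∧ i ∈ B then α i else 0 := by
      intro i r
      have h' : ∀ j, (assemble (A := A) i false r = assemble j false fun _ => CellModel.idle)
          ↔ (i = j ∧ r = fun _ => CellModel.idle) := by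
        intro j
        have := (assemble_injective (A := A) fun _ : Fin n → Bool => false).eq_iff
          (a := (i, r)) (b := (j, fun _ => CellModel.idle))
        simpa using this
      simp only [Finset.sum_apply, Pi.smul_apply, initialBasis, Pi.single_apply, h']
      by_cases hr : r = fun _ => CellModel.idle
      · simp [hr]
      · simp [hr]
    simp only [h]
    rw [Finset.sum_eq_single (fun _ => CellModel.idle)]
    · simp [apply_ite, Finset.sum_ite_mem]
    · intro r _ hr
      simp [hr]
    · simp
  · intro d hd
    simp only [Finset.sum_apply, Pi.smul_apply, initialBasis, Pi.single_apply]
    refine Finset.sum_eq_zero fun i _ => ?_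
    rw [if_neg (hd i _), smul_zero]

/-- If the branches of all addresses in `G` end, for each Kraus operator, in the correct state of
address and bus and in a common state of the routers, then the infidelity is bounded by the weight
of the other addresses. -/
theorem infidelity_kraus_le {ι : Type*} [Fintype ι] (x : (Fin n → Bool) → Bool)
    {α : (Fin n → Bool) → ℂ} (hα : ∑ i, ‖α i‖ ^ 2 = 1)
    (T : ι → Matrix (Config n A) (Config n A) ℂ) (hT : ∑ a, (T a)ᴴ * T a = 1)
    (G : Finset (Fin n → Bool))
    (hG : ∀ a, ∃ κ : (Node n × Site → A) → ℂ, ∀ i ∈ G,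
      (∀ r, (T a *ᵥ initialBasis A i) (assemble i (x i) r) = κ r) ∧
      ∀ d, (∀ r, d ≠ assemble i (x i) r) → (T a *ᵥ initialBasis A i) d = 0) :
    1 - fidelity x α (∑ a, T a * initialState α * (T a)ᴴ) ≤ 4 * ∑ i ∈ Gᶜ, ‖α i‖ ^ 2 := by
  classical
  choose κ hκ using hG
  have hw : normSqVec (initialVec (A := A) α) = 1 := by
    rw [initialVec_eq, normSqVec_sum_initialBasis, hα]
  have hsum : ∑ i ∈ G, ‖α i‖ ^ 2 + ∑ i ∈ Gᶜ, ‖α i‖ ^ 2 = 1 := by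
    rw [Finset.sum_add_sum_compl, hα]
  -- Trace preservation writes the leading `1` as the total squared norm of the Kraus branches.
  have hL : 1 - fidelity x α (∑ a, T a * initialState α * (T a)ᴴ)
      = ∑ a, defect x α (T a *ᵥ initialVec α) := by
    have : ∀ a, T a * initialState α * (T a)ᴴ
        = Matrix.vecMulVec (T a *ᵥ initialVec α) (star (T a *ᵥ initialVec α)) := by
      intro a
      rw [initialState, Matrix.mul_vecMulVec, Matrix.vecMulVec_mul, Matrix.star_mulVec]
    simp only [this, fidelity_sum, fidelity_vecMulVec, defect, Finset.sum_sub_distrib]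
    rw [sum_normSqVec_mulVec T hT, hw]
  rw [hL]
  -- The normalisation of `κ` below is read off from one good address; without any, the bad weight
  -- is `1` and the bound is trivial.
  rcases G.eq_empty_or_nonempty with rfl | ⟨i₀, hi₀⟩
  · have : ∑ a, defect x α (T a *ᵥ initialVec α) ≤ 1 := by
      rw [← hw, ← sum_normSqVec_mulVec T hT]
      exact Finset.sum_le_sum fun a _ => defect_le_normSqVec _ _ _
    simp only [Finset.sum_empty, zero_add] at hsum
    linarith
  set u : ι → Config n A → ℂ := fun a => ∑ i ∈ G, α i • (T a *ᵥ initialBasis A i) with hu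
  set v : Config n A → ℂ := ∑ i ∈ Gᶜ, α i • initialBasis A i with hv
  have hsplit : ∀ a, T a *ᵥ initialVec α = u a + T a *ᵥ v := by
    intro a
    rw [initialVec_eq, ← Finset.sum_add_sum_compl G, Matrix.mulVec_add, hu, Matrix.mulVec_sum]
    simp only [Matrix.mulVec_smul]
    rfl
  have hκn : ∀ a, ∀ i ∈ G, normSqVec (T a *ᵥ initialBasis A i) = ∑ r, ‖κ a r‖ ^ 2 := by
    intro a i hi
    rw [normSqVec_eq_sum_assemble x _ fun d hd => (hκ a i hi).2 d (hd i)]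
    refine Finset.sum_congr rfl fun r _ => ?_
    rw [Finset.sum_eq_single i, (hκ a i hi).1]
    · intro j _ hj
      rw [(hκ a i hi).2, norm_zero, zero_pow two_ne_zero]
      intro s hs
      exact hj (congrArg Prod.fst (assemble_injective x (a₁ := (j, r)) (a₂ := (i, s)) hs))
    · simp
  have hκ1 : ∑ a, ∑ r, ‖κ a r‖ ^ 2 = 1 := by
    rw [← normSqVec_initialBasis (A := A) i₀, ← sum_normSqVec_mulVec T hT]
    exact Finset.sum_congr rfl fun a _ => (hκn a i₀ hi₀).symm
  have hu1 : ∀ a i r, u a (assemble i (x i) r) = if i ∈ G then α i * κ a r else 0 := by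
    intro a i r
    have h : ∀ j ∈ G, (T a *ᵥ initialBasis A j) (assemble i (x i) r)
        = if i = j then κ a r else 0 := by
      intro j hj
      split_ifs with hij
      · rw [hij, (hκ a j hj).1]
      · refine (hκ a j hj).2 _ fun s hs => hij ?_
        exact congrArg Prod.fst (assemble_injective x (a₁ := (i, r)) (a₂ := (j, s)) hs)
    have h' : u a (assemble i (x i) r)
        = ∑ j ∈ G, α j * (T a *ᵥ initialBasis A j) (assemble i (x i) r) := by
      simp [hu, Finset.sum_apply]
    rw [h', Finset.sum_congr rfl fun j hj => by rw [h j hj]]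
    simp
  -- With `w` the weight of `G`, the defect equals `(w - w²) ∑ ‖κ‖²`, and `w (1 - w) ≤ 1 - w`.
  have hdu : ∀ a, defect x α (u a) ≤ (∑ i ∈ Gᶜ, ‖α i‖ ^ 2) * ∑ r, ‖κ a r‖ ^ 2 := by
    intro a
    have h₁ : normSqVec (u a) = (∑ i ∈ G, ‖α i‖ ^ 2) * ∑ r, ‖κ a r‖ ^ 2 := by
      rw [normSqVec_eq_sum_assemble x, Finset.sum_mul, Finset.sum_comm]
      · rw [← Finset.sum_subset (Finset.subset_univ G)]
        · refine Finset.sum_congr rfl fun i hi => ?_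
          rw [Finset.mul_sum]
          refine Finset.sum_congr rfl fun r _ => ?_
          rw [hu1, if_pos hi, norm_mul, mul_pow]
        · intro i _ hi
          refine Finset.sum_eq_zero fun r _ => ?_
          rw [hu1, if_neg hi, norm_zero, zero_pow two_ne_zero]
      · intro d hd
        have h' : u a d = ∑ i ∈ G, (α i • (T a *ᵥ initialBasis A i)) d := by
          simp [hu, Finset.sum_apply]
        rw [h']
        refine Finset.sum_eq_zero fun i hi => ?_
        rw [Pi.smul_apply, (hκ a i hi).2 d (hd i), smul_zero]
    have h₂ : ∑ r, ‖overlap x α (u a) r‖ ^ 2 = (∑ i ∈ G, ‖α i‖ ^ 2) ^ 2 * ∑ r, ‖κ a r‖ ^ 2 := by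
      rw [Finset.mul_sum]
      refine Finset.sum_congr rfl fun r _ => ?_
      have : overlap x α (u a) r = ((∑ i ∈ G, ‖α i‖ ^ 2 : ℝ) : ℂ) * κ a r := by
        simp only [overlap, hu1, mul_ite, mul_zero, Finset.sum_ite_mem, Finset.univ_inter,
          Complex.ofReal_sum, Finset.sum_mul]
        refine Finset.sum_congr rfl fun i _ => ?_
        rw [← mul_assoc, Complex.conj_mul', Complex.ofReal_pow]
      rw [this, norm_mul, mul_pow, Complex.norm_real, Real.norm_eq_abs, sq_abs]
    rw [defect, h₁, h₂, ← sub_mul]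
    have hs : 0 ≤ ∑ r, ‖κ a r‖ ^ 2 := by positivity
    refine mul_le_mul_of_nonneg_right ?_ hs
    have : 0 ≤ ∑ i ∈ Gᶜ, ‖α i‖ ^ 2 := by positivity
    nlinarith
  -- The good part `u` and the bad part `v` each contribute twice the weight of the bad addresses,
  -- hence the factor `4`.
  calc ∑ a, defect x α (T a *ᵥ initialVec α)
      ≤ ∑ a, (2 * ((∑ i ∈ Gᶜ, ‖α i‖ ^ 2) * ∑ r, ‖κ a r‖ ^ 2) + 2 * normSqVec (T a *ᵥ v)) := by
        refine Finset.sum_le_sum fun a _ => ?_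
        rw [hsplit]
        linarith [defect_add_le x hα (u a) (T a *ᵥ v), hdu a,
          defect_le_normSqVec x α (T a *ᵥ v)]
    _ = 4 * ∑ i ∈ Gᶜ, ‖α i‖ ^ 2 := by
        rw [Finset.sum_add_distrib, ← Finset.mul_sum, ← Finset.mul_sum, ← Finset.mul_sum, hκ1,
          sum_normSqVec_mulVec T hT, hv, normSqVec_sum_initialBasis]
        ring

end Infidelity

/-! ### Fault patterns, and the confinement of errors to a set of cells. -/

section Histories

variable {n : ℕ} {A : Type}

/-- The noiseless evolution of a basis state. -/
def run (L : List (Gate n A)) (c : Config n A) : Config n A := L.foldl (fun c g => g.act c) c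

@[simp] theorem run_nil (c : Config n A) : run [] c = c := rfl

@[simp] theorem run_cons (g : Gate n A) (L : List (Gate n A)) (c : Config n A) :
    run (g :: L) c = run L (g.act c) := rfl

theorem run_append (L L' : List (Gate n A)) (c : Config n A) :
    run (L ++ L') c = run L' (run L c) := List.foldl_append ..

/-- In the basis state `c`, the gate `g` does not transfer contents between `D` and its
complement: either it never does so, or it acts trivially whatever the contents of `D` are. -/
def Separates (D : Finset (Cell n)) (g : Gate n A) (c : Config n A) : Prop :=
  (∀ c r, g.act (D.piecewise r c) = D.piecewise (g.act r) (g.act c)) ∨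
    ∀ r, g.act (D.piecewise r c) = D.piecewise r c

/-- Along the noiseless evolution from `c`, each gate separates `D` from its complement. -/
def Safe (D : Finset (Cell n)) : List (Gate n A) → Config n A → Prop
  | [], _ => True
  | g :: L, c => Separates D g c ∧ Safe D L (g.act c)

theorem safe_append {D : Finset (Cell n)} {L L' : List (Gate n A)} {c : Config n A}
    (h : Safe D L c) (h' : Safe D L' (run L c)) : Safe D (L ++ L') c := by
  induction L generalizing c with
  | nil => exact h'
  | cons g L ih => exact ⟨h.1, ih h.2 h'⟩

/-- Off `D`, the vector `v` is in the basis state `c`; on `D`, it is in the state `χ`. -/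
def Splits (D : Finset (Cell n)) (v : Config n A → ℂ) (c : Config n A) (χ : Config n A → ℂ) :
    Prop :=
  (∀ r, v (D.piecewise r c) = χ r) ∧ ∀ d, (∃ q, q ∉ D ∧ d q ≠ c q) → v d = 0

theorem eq_piecewise_of_agree {D : Finset (Cell n)} {c d : Config n A}
    (h : ∀ q, q ∉ D → d q = c q) : d = D.piecewise d c := by
  funext q
  by_cases hq : q ∈ D
  · rw [Finset.piecewise_eq_of_mem _ _ _ hq]
  · rw [Finset.piecewise_eq_of_notMem _ _ _ hq, h q hq]

variable [Fintype A] [DecidableEq A]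

/-- One operation, followed by its fault if the flag is set. -/
def faultStep (E : FaultModel n A) (ρ : Matrix (Config n A) (Config n A) ℂ)
    (m : (Gate n A × ℕ) × Bool) : Matrix (Config n A) (Config n A) ℂ :=
  let σ := ρ.submatrix m.1.1.act.symm m.1.1.act.symm
  if m.2 then (E m.1.2 m.1.1.support).apply σ else σ

theorem noisyOp_eq (p : ℝ) (E : FaultModel n A) (g : Gate n A × ℕ)
    (ρ : Matrix (Config n A) (Config n A) ℂ) :
    noisyOp p g.1 (E g.2 g.1.support) ρ
      = ((1 - p : ℝ) : ℂ) • faultStep E ρ (g, false) + (p : ℂ) • faultStep E ρ (g, true) := rfl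

/-- The first alternative of `Separates` does not depend on the branch. So either it holds for all
branches at once and `χ` is transported by the gate, or the gate acts trivially in every branch of
`G` and `χ` is kept. In both cases the new vector is common to all branches. -/
theorem splits_permMatrix (D : Finset (Cell n)) (g : Gate n A) {ι : Type*} (G : Finset ι)
    (v : ι → Config n A → ℂ) (c : ι → Config n A) (χ : Config n A → ℂ)
    (hv : ∀ i ∈ G, Splits D (v i) (c i) χ) (hg : ∀ i ∈ G, Separates D g (c i)) :
    ∃ χ', ∀ i ∈ G, Splits D (permMatrix g.act *ᵥ v i) (g.act (c i)) χ' := by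
  by_cases hA : ∀ c r, g.act (D.piecewise r c) = D.piecewise (g.act r) (g.act c)
  · refine ⟨fun r => χ (g.act.symm r), fun i hi => ⟨fun r => ?_, fun d ⟨q, hq, hd⟩ => ?_⟩⟩
    · rw [permMatrix_mulVec]
      refine Eq.trans ?_ ((hv i hi).1 _)
      congr 1
      rw [Equiv.symm_apply_eq, hA, Equiv.apply_symm_apply]
    · rw [permMatrix_mulVec]
      refine (hv i hi).2 _ (by_contra fun h => hd ?_)
      push Not at h
      have := congrArg g.act (eq_piecewise_of_agree h)
      rw [hA, Equiv.apply_symm_apply] at this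
      rw [this, Finset.piecewise_eq_of_notMem _ _ _ hq]
  · have hB : ∀ i ∈ G, ∀ r, g.act (D.piecewise r (c i)) = D.piecewise r (c i) := fun i hi =>
      (hg i hi).resolve_left hA
    have hc : ∀ i ∈ G, g.act (c i) = c i := fun i hi => by
      have h : D.piecewise (c i) (c i) = c i := by
        funext q
        exact ite_self _
      rw [← h, hB i hi]
    refine ⟨χ, fun i hi => ⟨fun r => ?_, fun d ⟨q, hq, hd⟩ => ?_⟩⟩
    · rw [permMatrix_mulVec, ← (hv i hi).1, hc i hi]
      congr 1
      rw [Equiv.symm_apply_eq, hB i hi]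
    · rw [permMatrix_mulVec]
      rw [hc i hi] at hd
      refine (hv i hi).2 _ (by_contra fun h => hd ?_)
      push Not at h
      have := congrArg g.act (eq_piecewise_of_agree h)
      rw [hB i hi, Equiv.apply_symm_apply] at this
      rw [this, Finset.piecewise_eq_of_notMem _ _ _ hq]

/-- The resulting vector on `D` is expressed without `c`, so a fault inside `D` cannot distinguish
the branches. -/
theorem splits_extend (D S : Finset (Cell n)) (hS : S ⊆ D) (K : Matrix (S → A) (S → A) ℂ)
    {v : Config n A → ℂ} {c : Config n A} {χ : Config n A → ℂ} (hv : Splits D v c χ) :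
    Splits D (extend S K *ᵥ v) c (fun r => ∑ s : S → A, K (fun q => r q) s * χ (glue S r s)) := by
  refine ⟨fun r => ?_, fun d ⟨q, hq, hd⟩ => ?_⟩
  · rw [extend_mulVec]
    refine Finset.sum_congr rfl fun s _ => ?_
    have h₁ : (fun q : S => D.piecewise r c q) = fun q : S => r q := by
      funext q
      rw [Finset.piecewise_eq_of_mem _ _ _ (hS q.2)]
    have h₂ : glue S (D.piecewise r c) s = D.piecewise (glue S r s) c := by
      funext q
      by_cases hq : q ∈ S
      · rw [Finset.piecewise_eq_of_mem _ _ _ (hS hq)]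
        simp [glue, hq]
      · rw [glue_of_notMem _ _ hq]
        by_cases hD : q ∈ D
        · rw [Finset.piecewise_eq_of_mem _ _ _ hD, Finset.piecewise_eq_of_mem _ _ _ hD,
            glue_of_notMem _ _ hq]
        · rw [Finset.piecewise_eq_of_notMem _ _ _ hD, Finset.piecewise_eq_of_notMem _ _ _ hD]
    rw [h₁, h₂, hv.1]
  · rw [extend_mulVec]
    refine Finset.sum_eq_zero fun s _ => ?_
    rw [hv.2 _ ⟨q, hq, ?_⟩, mul_zero]
    rwa [glue_of_notMem _ _ fun h => hq (hS h)]

/-- Kraus operators of one operation with or without its fault. -/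
theorem exists_kraus_faultStep (E : FaultModel n A) (D : Finset (Cell n))
    (m : (Gate n A × ℕ) × Bool) (hm : m.2 = true → m.1.1.support ⊆ D) {κ : Type}
    (G : Finset κ) :
    ∃ (ι : Type) (_ : Fintype ι) (T : ι → Matrix (Config n A) (Config n A) ℂ),
      (∀ ρ, faultStep E ρ m = ∑ a, T a * ρ * (T a)ᴴ) ∧ ∑ a, (T a)ᴴ * T a = 1 ∧
      ∀ (v : κ → Config n A → ℂ) (c : κ → Config n A) (χ : Config n A → ℂ),
        (∀ i ∈ G, Splits D (v i) (c i) χ) → (∀ i ∈ G, Separates D m.1.1 (c i)) →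
          ∀ a, ∃ χ', ∀ i ∈ G, Splits D (T a *ᵥ v i) (m.1.1.act (c i)) χ' := by
  obtain ⟨⟨g, j⟩, b⟩ := m
  cases b with
  | false =>
    refine ⟨Unit, inferInstance, fun _ => permMatrix g.act, fun ρ => ?_, ?_, ?_⟩
    · simp [permMatrix_conj, faultStep]
    · simp [permMatrix_unitary]
    · intro v c χ hv hg _
      exact splits_permMatrix D g G v c χ hv hg
  | true =>
    refine ⟨Fin (E j g.support).size, inferInstance,
      fun a => extend g.support ((E j g.support).kraus a) * permMatrix g.act,
      fun ρ => ?_, ?_, ?_⟩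
    · simp only [faultStep, if_true, Channel.apply, ← permMatrix_conj, Matrix.conjTranspose_mul,
        Matrix.mul_assoc]
    · have : ∀ K : Matrix (Config n A) (Config n A) ℂ, (K * permMatrix g.act)ᴴ
          * (K * permMatrix g.act) = (permMatrix g.act)ᴴ * (Kᴴ * K) * permMatrix g.act := by
        intro K
        simp only [Matrix.conjTranspose_mul, Matrix.mul_assoc]
      simp only [this]
      rw [← Finset.sum_mul, ← Finset.mul_sum, Channel.sum_extend, mul_one, permMatrix_unitary]
    · intro v c χ hv hg a
      obtain ⟨χ', hχ'⟩ := splits_permMatrix D g G v c χ hv hg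
      exact ⟨_, fun i hi => by
        rw [← Matrix.mulVec_mulVec]
        exact splits_extend D g.support (hm rfl) _ (hχ' i hi)⟩

/-- Kraus operators of a sequence of operations with given faults. -/
theorem exists_kraus_history (E : FaultModel n A) (D : Finset (Cell n))
    (M : List ((Gate n A × ℕ) × Bool)) (hM : ∀ m ∈ M, m.2 = true → m.1.1.support ⊆ D)
    {κ : Type} (G : Finset κ) :
    ∃ (ι : Type) (_ : Fintype ι) (T : ι → Matrix (Config n A) (Config n A) ℂ),
      (∀ ρ, M.foldl (faultStep E) ρ = ∑ a, T a * ρ * (T a)ᴴ) ∧ ∑ a, (T a)ᴴ * T a = 1 ∧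
      ∀ (v : κ → Config n A → ℂ) (c : κ → Config n A) (χ : Config n A → ℂ),
        (∀ i ∈ G, Splits D (v i) (c i) χ) →
        (∀ i ∈ G, Safe D (M.map fun m => m.1.1) (c i)) →
          ∀ a, ∃ χ', ∀ i ∈ G, Splits D (T a *ᵥ v i) (run (M.map fun m => m.1.1) (c i)) χ' := by
  induction M with
  | nil =>
    refine ⟨Unit, inferInstance, fun _ => 1, fun ρ => by simp, by simp, ?_⟩
    intro v c χ hv _ _
    exact ⟨χ, fun i hi => by simpa using hv i hi⟩
  | cons m M ih =>
    obtain ⟨ι, hι, T, hT₁, hT₂, hT₃⟩ := ih fun m' hm' => hM m' (List.mem_cons_of_mem _ hm')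
    obtain ⟨ι', hι', T', hT₁', hT₂', hT₃'⟩ :=
      exists_kraus_faultStep E D m (hM m List.mem_cons_self) G
    refine ⟨ι × ι', inferInstance, fun a => T a.1 * T' a.2, fun ρ => ?_, ?_, ?_⟩
    · rw [List.foldl_cons, hT₁, hT₁', Fintype.sum_prod_type]
      refine Finset.sum_congr rfl fun a _ => ?_
      rw [Finset.mul_sum, Finset.sum_mul]
      refine Finset.sum_congr rfl fun b _ => ?_
      simp only [Matrix.conjTranspose_mul, Matrix.mul_assoc]
    · rw [Fintype.sum_prod_type_right, ← hT₂']
      refine Finset.sum_congr rfl fun b _ => ?_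
      have : ∀ a, (T a * T' b)ᴴ * (T a * T' b) = (T' b)ᴴ * ((T a)ᴴ * T a) * T' b := by
        intro a
        simp only [Matrix.conjTranspose_mul, Matrix.mul_assoc]
      simp only [this]
      rw [← Finset.sum_mul, ← Finset.mul_sum, hT₂, mul_one]
    · intro v c χ hv hs a
      obtain ⟨χ', hχ'⟩ := hT₃' v c χ hv (fun i hi => (hs i hi).1) a.2
      obtain ⟨χ'', hχ''⟩ := hT₃ _ _ χ' hχ' (fun i hi => (hs i hi).2) a.1
      refine ⟨χ'', fun i hi => ?_⟩
      rw [← Matrix.mulVec_mulVec]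
      exact hχ'' i hi

variable [CellModel A] [LawfulCell A]

theorem infidelity_eq (k : ℕ) (x : (Fin n → Bool) → Bool) (ε : ErrorRates) (E : FaultModel n A)
    (α : (Fin n → Bool) → ℂ) :
    infidelity k x ε E α = 1 - fidelity x α (finalState k x ε E α) := rfl

open Classical in
/-- It suffices to bound the infidelity for each pattern of faults. -/
theorem infidelity_le_of_histories (k : ℕ) (x : (Fin n → Bool) → Bool) (ε : ErrorRates)
    (E : FaultModel n A) (α : (Fin n → Bool) → ℂ) (hp : ∀ o, 0 ≤ faultProb k ε o)
    (hp' : ∀ o, faultProb k ε o ≤ 1) (touch : (Fin n → Bool) → Gate n A → Prop)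
    (H : ∀ M : List ((Gate n A × ℕ) × Bool), M.map Prod.fst = (operations n A x).zipIdx →
      1 - fidelity x α (M.foldl (faultStep E) (initialState α))
        ≤ 4 * ∑ i, ‖α i‖ ^ 2 * if ∃ m ∈ M, m.2 = true ∧ touch i m.1.1 then 1 else 0) :
    infidelity k x ε E α ≤ 4 * ∑ i, ‖α i‖ ^ 2 *
      ((operations n A x).map fun g => if touch i g then faultProb k ε g.kind else 0).sum := by
  -- `M` records the operations whose fault flag is already decided, `L` those that are still noisy.
  -- Induction on `L` decides one more flag at a time.
  have key : ∀ (L : List (Gate n A × ℕ)) (M : List ((Gate n A × ℕ) × Bool)),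
      M.map Prod.fst ++ L = (operations n A x).zipIdx →
      1 - fidelity x α (L.foldl (fun ρ g => noisyOp (faultProb k ε g.1.kind) g.1
          (E g.2 g.1.support) ρ) (M.foldl (faultStep E) (initialState α)))
        ≤ 4 * ∑ i, ‖α i‖ ^ 2 * ((if ∃ m ∈ M, m.2 = true ∧ touch i m.1.1 then 1 else 0)
          + (L.map fun g => if touch i g.1 then faultProb k ε g.1.kind else 0).sum) := by
    intro L
    induction L with
    | nil =>
      intro M hM
      simpa using H M (by simpa using hM)
    | cons g L ih =>
      intro M hM
      -- The remaining noisy evolution is linear, so the mixture created by one operation passes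
      -- through it.
      have hlin : ∀ (L : List (Gate n A × ℕ)) (p : ℝ) (ρ σ : Matrix (Config n A) (Config n A) ℂ),
          L.foldl (fun ρ g => noisyOp (faultProb k ε g.1.kind) g.1 (E g.2 g.1.support) ρ)
            (((1 - p : ℝ) : ℂ) • ρ + (p : ℂ) • σ)
          = ((1 - p : ℝ) : ℂ) • L.foldl (fun ρ g => noisyOp (faultProb k ε g.1.kind) g.1
              (E g.2 g.1.support) ρ) ρ
            + (p : ℂ) • L.foldl (fun ρ g => noisyOp (faultProb k ε g.1.kind) g.1
              (E g.2 g.1.support) ρ) σ := by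
        intro L p
        induction L with
        | nil => intro ρ σ; rfl
        | cons g L ih =>
          intro ρ σ
          rw [List.foldl_cons, List.foldl_cons, List.foldl_cons, ← ih]
          congr 1
          simp only [noisyOp, Channel.apply, Matrix.submatrix_add, Matrix.submatrix_smul,
            Pi.add_apply, Pi.smul_apply, Matrix.mul_add, Matrix.add_mul, Matrix.mul_smul,
            Matrix.smul_mul, Finset.sum_add_distrib, ← Finset.smul_sum, smul_add]
          simp only [smul_smul, mul_comm]
          abel
      set p := faultProb k ε g.1.kind with hpdef
      rw [List.foldl_cons, noisyOp_eq, hlin, fidelity_add, fidelity_smul, fidelity_smul]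
      have h₀ := ih (M ++ [(g, false)]) (by simpa using hM)
      have h₁ := ih (M ++ [(g, true)]) (by simpa using hM)
      rw [List.foldl_append, List.foldl_cons, List.foldl_nil] at h₀ h₁
      have hp0 : 0 ≤ p := hp _
      have hp1 : 0 ≤ 1 - p := sub_nonneg.2 (hp' _)
      have h₂ := add_le_add (mul_le_mul_of_nonneg_left h₀ hp1) (mul_le_mul_of_nonneg_left h₁ hp0)
      refine le_trans (le_of_eq (by ring)) (h₂.trans ?_)
      rw [mul_left_comm, mul_left_comm p, ← mul_add, Finset.mul_sum, Finset.mul_sum,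
        ← Finset.sum_add_distrib]
      refine mul_le_mul_of_nonneg_left (Finset.sum_le_sum fun i _ => ?_) (by norm_num)
      rw [mul_left_comm, mul_left_comm p, ← mul_add]
      refine mul_le_mul_of_nonneg_left ?_ (by positivity)
      have e₀ : (∃ m ∈ M ++ [(g, false)], m.2 = true ∧ touch i m.1.1)
          ↔ ∃ m ∈ M, m.2 = true ∧ touch i m.1.1 := by
        simp [or_and_right, exists_or]
      have e₁ : (∃ m ∈ M ++ [(g, true)], m.2 = true ∧ touch i m.1.1)
          ↔ (∃ m ∈ M, m.2 = true ∧ touch i m.1.1) ∨ touch i g.1 := by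
        simp [or_and_right, exists_or]
      rw [if_congr e₀ rfl rfl, if_congr e₁ rfl rfl, List.map_cons, List.sum_cons]
      -- Union bound: a fault of `g` spoils address `i` only if `g` touches it, which adds at most
      -- `p` to the probability.
      by_cases hb : ∃ m ∈ M, m.2 = true ∧ touch i m.1.1 <;> by_cases ht : touch i g.1 <;>
        simp only [hb, ht, if_true, if_false, or_true, or_false, ← hpdef] <;> nlinarith
  have := key _ [] rfl
  simp only [List.foldl_nil, List.not_mem_nil, false_and, exists_false, if_false, zero_add] at this
  rw [infidelity_eq]
  refine le_trans this (le_of_eq ?_)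
  congr 1
  refine Finset.sum_congr rfl fun i _ => ?_
  congr 2
  conv_rhs => rw [← List.zipIdx_map_fst 0 (operations n A x), List.map_map]
  rfl

end Histories

/-! ### Routers on the path to an address, and the timetable of the items. -/

section Path

variable {n : ℕ}

/-- The router of level `ℓ` on the path to address `i`. -/
def pathNode (i : Fin n → Bool) (ℓ : Fin n) : Node n := ⟨ℓ, fun j => i ⟨j, j.2.trans ℓ.2⟩⟩

/-- The cells that may hold an item of the query of address `i`. -/
def Tracked (i : Fin n → Bool) : Cell n → Prop
  | .addr _ => True
  | .bus => True
  | .router v (.port b) => v = pathNode i v.1 ∧ i v.1 = b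
  | .router v .status => v = pathNode i v.1
  | .router v .input => v = pathNode i v.1

/-- The address and bus cells and all cells of the routers on the path to address `i`. -/
def Nearby (i : Fin n → Bool) : Cell n → Prop
  | .addr _ => True
  | .bus => True
  | .router v _ => v = pathNode i v.1

instance (i : Fin n → Bool) : DecidablePred (Nearby i) := fun q => by
  cases q <;> unfold Nearby <;> infer_instance

theorem Tracked.nearby {i : Fin n → Bool} {q : Cell n} (h : Tracked i q) : Nearby i q := by
  match q, h with
  | .addr _, _ => trivial
  | .bus, _ => trivial
  | .router _ (.port _), h => exact h.1
  | .router _ .status, h => exact h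
  | .router _ .input, h => exact h

theorem child_eq_pathNode_iff (i : Fin n → Bool) (v : Node n) (b : Bool) (h : (v.1 : ℕ) + 1 < n) :
    child v b h = pathNode i (child v b h).1 ↔ v = pathNode i v.1 ∧ i v.1 = b := by
  obtain ⟨ℓ, a⟩ := v
  simp only [child, pathNode, Sigma.mk.injEq, heq_eq_eq, true_and]
  constructor
  · intro H
    refine ⟨funext fun j => ?_, ?_⟩
    · have := congrFun H ⟨j, j.2.trans (Nat.lt_succ_self _)⟩
      simpa using this
    · have := congrFun H ⟨ℓ, by simp⟩
      simpa using this.symm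
  · rintro ⟨H, rfl⟩
    funext j
    split_ifs with hj
    · exact congrFun H ⟨j, hj⟩
    · have : (j : ℕ) = ℓ := 
        le_antisymm (Nat.lt_succ_iff.1 j.2) (not_lt.1 hj)
      exact congrArg i (Fin.ext this.symm)

theorem child_pathNode (i : Fin n → Bool) (ℓ : Fin n) (h : (ℓ : ℕ) + 1 < n) :
    child (pathNode i ℓ) (i ℓ) h = pathNode i ⟨ℓ + 1, h⟩ :=
  (child_eq_pathNode_iff i (pathNode i ℓ) (i ℓ) h).2 ⟨rfl, rfl⟩

theorem mem_levelNodes {j : ℕ} {v : Node n} : v ∈ levelNodes n j ↔ (v.1 : ℕ) = j := by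
  simp [levelNodes]

theorem eq_pathNode_of_mem_levelNodes_zero (i : Fin n → Bool) {v : Node n}
    (hv : v ∈ levelNodes n 0) : v = pathNode i v.1 := by
  obtain ⟨⟨ℓ, hℓ⟩, a⟩ := v
  obtain rfl : ℓ = 0 := mem_levelNodes.1 hv
  simp only [pathNode, Sigma.mk.injEq, heq_eq_eq, true_and]
  funext j
  exact j.elim0

/-- The cell `s` of the router of level `j` on the path to `i`. -/
def pathCell (i : Fin n → Bool) (j : ℕ) (s : Site) : Cell n :=
  if h : j < n then .router (pathNode i ⟨j, h⟩) s else .bus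

/-- The bits of an address, as a function on `ℕ`. -/
def bitAt (i : Fin n → Bool) (j : ℕ) : Bool := if h : j < n then i ⟨j, h⟩ else false

/-- The cell where the item `ℓ` is kept when it is not in the tree. -/
def itemHome (n ℓ : ℕ) : Cell n := if h : ℓ < n then .addr ⟨ℓ, h⟩ else .bus

/-- The cell that contains item `ℓ` of the query of address `i` after the first `s` of its steps. -/
def itemPos (i : Fin n → Bool) (ℓ : ℕ) : ℕ → Cell n
  | 0 => itemHome n ℓ
  | s + 1 =>
    if 3 * ℓ + 1 ≤ s ∧ ℓ < n then pathCell i ℓ .status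
    else if s % 3 = 0 ∨ (s % 3 = 1 ∧ bitAt i (s / 3) = true) then pathCell i (s / 3) .input
    else pathCell i (s / 3) (.port (bitAt i (s / 3)))

theorem itemPos_zero (i : Fin n → Bool) (ℓ : ℕ) : itemPos i ℓ 0 = itemHome n ℓ := rfl

theorem itemPos_succ (i : Fin n → Bool) (ℓ s : ℕ) :
    itemPos i ℓ (s + 1) = if 3 * ℓ + 1 ≤ s ∧ ℓ < n then pathCell i ℓ .status
      else if s % 3 = 0 ∨ (s % 3 = 1 ∧ bitAt i (s / 3) = true) then pathCell i (s / 3) .input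
      else pathCell i (s / 3) (.port (bitAt i (s / 3))) := rfl

/-- The cell that contains item `ℓ` of the query of address `i` at time `t` of the first half. -/
def itemAt (i : Fin n → Bool) (ℓ t : ℕ) : Cell n := itemPos i ℓ (t - startTime ℓ)

theorem pathCell_of_lt (i : Fin n → Bool) {j : ℕ} (h : j < n) (s : Site) :
    pathCell i j s = .router (pathNode i ⟨j, h⟩) s := dif_pos h

theorem bitAt_of_lt (i : Fin n → Bool) {j : ℕ} (h : j < n) : bitAt i j = i ⟨j, h⟩ := dif_pos h

theorem pathCell_inj {i : Fin n → Bool} {j j' : ℕ} (h : j < n) (h' : j' < n) {s s' : Site}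
    (H : pathCell i j s = pathCell i j' s') : j = j' ∧ s = s' := by
  rw [pathCell_of_lt i h, pathCell_of_lt i h', Cell.router.injEq] at H
  exact ⟨congrArg (fun v : Node n => (v.1 : ℕ)) H.1, H.2⟩

theorem pathCell_ne_itemHome {i : Fin n → Bool} {j : ℕ} (h : j < n) (s : Site) (ℓ : ℕ) :
    pathCell i j s ≠ itemHome n ℓ := by
  rw [pathCell_of_lt i h, itemHome]
  split_ifs <;> simp

theorem itemHome_inj {ℓ ℓ' : ℕ} (h : ℓ ≤ n) (h' : ℓ' ≤ n) (H : itemHome n ℓ = itemHome n ℓ') :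
    ℓ = ℓ' := by
  unfold itemHome at H
  split_ifs at H with h₁ h₂ h₂
  · simpa using H
  · omega

theorem tracked_pathCell (i : Fin n → Bool) (j : ℕ) {s : Site}
    (hs : ∀ b, s = .port b → b = bitAt i j) : Tracked i (pathCell i j s) := by
  unfold pathCell
  split_ifs with h
  · cases s with
    | status => exact rfl
    | input => exact rfl
    | port b => exact ⟨rfl, by rw [hs b rfl, bitAt_of_lt i h]; rfl⟩
  · trivial

theorem tracked_itemAt (i : Fin n → Bool) (ℓ t : ℕ) : Tracked i (itemAt i ℓ t) := by
  unfold itemAt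
  cases t - startTime ℓ with
  | zero =>
    rw [itemPos_zero, itemHome]
    split_ifs <;> trivial
  | succ s =>
    rw [itemPos_succ]
    split_ifs
    · exact tracked_pathCell _ _ (by simp)
    · exact tracked_pathCell _ _ (by simp)
    · exact tracked_pathCell _ _ (by simp)

/-- Two items never meet, not even if one of them is a time step ahead. -/
theorem itemAt_ne_of_lt (i : Fin n → Bool) {ℓ ℓ' t u u' : ℕ} (hℓ : ℓ < ℓ') (hℓ' : ℓ' ≤ n)
    (ht : t + 1 ≤ 7 * n - 2) (hu : u = t ∨ u = t + 1) (hu' : u' = t ∨ u' = t + 1) :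
    itemAt i ℓ u ≠ itemAt i ℓ' u' := by
  intro H
  unfold itemAt at H
  have e₁ : startTime ℓ = 4 * ℓ - 2 := rfl
  have e₂ : startTime ℓ' = 4 * ℓ' - 2 := rfl
  rw [e₁, e₂] at H
  rcases ha : u - (4 * ℓ - 2) with _ | a <;> rcases hb : u' - (4 * ℓ' - 2) with _ | b <;>
    rw [ha, hb] at H <;> simp only [itemPos_zero, itemPos_succ] at H
  · have := itemHome_inj (by omega) hℓ' H
    omega
  -- A later item cannot be in the tree while an earlier one is at home: start times differ by at
  -- least `2`, the two observation times by at most `1`.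
  · omega
  · split_ifs at H
    · exact pathCell_ne_itemHome (by omega) _ _ H
    · exact pathCell_ne_itemHome (by omega) _ _ H
    · exact pathCell_ne_itemHome (by omega) _ _ H
  · have weak : ∀ s : ℕ, (s % 3 = 0 ∨ (s % 3 = 1 ∧ bitAt i (s / 3) = true)) →
        s % 3 = 0 ∨ s % 3 = 1 := fun s h => h.imp_right And.left
    have weak' : ∀ s : ℕ, ¬(s % 3 = 0 ∨ (s % 3 = 1 ∧ bitAt i (s / 3) = true)) → s % 3 ≠ 0 :=
      fun s h h' => h (Or.inl h')
    split_ifs at H with h₁ h₂ h₃ h₂ h₃ h₄ h₃ h₄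
    all_goals
      have h := pathCell_inj (by omega) (by omega) H
      simp only [reduceCtorEq, and_false, and_true, Site.port.injEq] at h
    · omega
    · have := weak _ h₂
      have := weak _ h₄
      omega
    · have := weak' _ h₂
      have := weak' _ h₄
      omega

theorem itemAt_ne (i : Fin n → Bool) {ℓ ℓ' t u u' : ℕ} (h : ℓ ≠ ℓ') (hℓ : ℓ ≤ n) (hℓ' : ℓ' ≤ n)
    (ht : t + 1 ≤ 7 * n - 2) (hu : u = t ∨ u = t + 1) (hu' : u' = t ∨ u' = t + 1) :
    itemAt i ℓ u ≠ itemAt i ℓ' u' := by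
  rcases lt_or_gt_of_ne h with h | h
  · exact itemAt_ne_of_lt i h hℓ' ht hu hu'
  · exact (itemAt_ne_of_lt i h hℓ ht hu' hu).symm

end Path

/-! ### Which gates keep the contents of `untracked G` apart from the rest. -/

section GateAction

variable {n : ℕ} {A : Type}

theorem swapCells_apply (p q z : Cell n) (c : Config n A) :
    swapCells p q c z = c (Equiv.swap p q z) := by
  simp [swapCells]

theorem swapCells_comm (p q : Cell n) :
    (swapCells p q : Equiv.Perm (Config n A)) = swapCells q p := by
  ext c z
  rw [swapCells_apply, swapCells_apply, Equiv.swap_comm]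

theorem swapCells_self (p : Cell n) (c : Config n A) : swapCells p p c = c := by
  funext z
  rw [swapCells_apply, Equiv.swap_self, Equiv.refl_apply]

theorem swapCells_eq_self {p q : Cell n} {c : Config n A} (h : c p = c q) :
    swapCells p q c = c := by
  funext z
  rw [swapCells_apply, Equiv.swap_apply_def]
  split_ifs with h₁ h₂
  · rw [h₁, h]
  · rw [h₂, h]
  · rfl

theorem swapCells_apply_of_ne {p q z : Cell n} (c : Config n A) (hp : z ≠ p) (hq : z ≠ q) :
    swapCells p q c z = c z := by
  rw [swapCells_apply, Equiv.swap_apply_of_ne_of_ne hp hq]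

theorem separates_of_act_eq_swapCells {D : Finset (Cell n)} {g : Gate n A} {p q : Cell n}
    (hg : g.act = swapCells p q) (h : p ∈ D ↔ q ∈ D) (c : Config n A) : Separates D g c := by
  refine Or.inl fun c r => ?_
  rw [hg]
  funext z
  have hz : Equiv.swap p q z ∈ D ↔ z ∈ D := by
    rw [Equiv.swap_apply_def]
    split_ifs with h₁ h₂
    · rw [h₁, h]
    · rw [h₂, h]
    · rfl
  by_cases hD : z ∈ D
  · rw [swapCells_apply, Finset.piecewise_eq_of_mem _ _ _ (hz.2 hD),
      Finset.piecewise_eq_of_mem _ _ _ hD, swapCells_apply]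
  · rw [swapCells_apply, Finset.piecewise_eq_of_notMem _ _ _ fun h => hD (hz.1 h),
      Finset.piecewise_eq_of_notMem _ _ _ hD, swapCells_apply]

theorem separates_idleGate (D : Finset (Cell n)) (q : Cell n) (c : Config n A) :
    Separates D (idleGate q) c := Or.inl fun _ _ => rfl

open Classical in
/-- The cells that are tracked for none of the addresses in `G`. -/
def untracked (G : Finset (Fin n → Bool)) : Finset (Cell n) :=
  Finset.univ.filter fun q => ∀ j ∈ G, ¬Tracked j q

theorem mem_untracked {G : Finset (Fin n → Bool)} {q : Cell n} :
    q ∈ untracked G ↔ ∀ j ∈ G, ¬Tracked j q := by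
  simp [untracked]

theorem mem_untracked_iff_of_tracked_iff {G : Finset (Fin n → Bool)} {p q : Cell n}
    (h : ∀ j, Tracked j p ↔ Tracked j q) : p ∈ untracked G ↔ q ∈ untracked G := by
  simp only [mem_untracked, h]

/-- Thus a long-range SWAP lies entirely inside or entirely outside `untracked G`. This is why
`Tracked` admits only the output that points along the path: the other output of a path router may
fill with errors from its subtree. -/
theorem tracked_port_iff_tracked_child (i : Fin n → Bool) (v : Node n) (b : Bool)
    (h : (v.1 : ℕ) + 1 < n) :
    Tracked i (.router v (.port b)) ↔ Tracked i (.router (child v b h) .input) :=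
  (child_eq_pathNode_iff i v b h).symm

variable [CellModel A]

/-- Routers with idle status route nothing, and writing does not change idle cells. -/
def Waits (A : Type) [CellModel A] : Prop :=
  CellModel.dir (CellModel.idle : A) = none ∧ CellModel.flip (CellModel.idle : A) = CellModel.idle

theorem cswapGate_act (v : Node n) (b : Bool) (c : Config n A) :
    (cswapGate v b).act c = if CellModel.dir (c (.router v .status)) = some b then
      swapCells (.router v .input) (.router v (.port b)) c else c := rfl

theorem cswapGate_act_of_ne {v : Node n} {b : Bool} {z : Cell n} (c : Config n A)
    (h₁ : z ≠ .router v .input) (h₂ : z ≠ .router v (.port b)) :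
    (cswapGate v b).act c z = c z := by
  rw [cswapGate_act]
  split_ifs
  · exact swapCells_apply_of_ne c h₁ h₂
  · rfl

theorem writeGate_act (x : (Fin n → Bool) → Bool) (v : Node n) (b : Bool) (c : Config n A)
    (z : Cell n) :
    (writeGate x v b).act c z = if z = .router v (.port b) ∧ x (leafAddress v b) = true then
      CellModel.flip (c z) else c z := by
  simp only [writeGate, Equiv.piCongrRight_apply, Pi.map_apply]
  split_ifs <;> rfl

theorem separates_writeGate (D : Finset (Cell n)) (x : (Fin n → Bool) → Bool) (v : Node n)
    (b : Bool) (c : Config n A) : Separates D (writeGate x v b) c := by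
  refine Or.inl fun c r => funext fun z => ?_
  by_cases hD : z ∈ D
  · rw [writeGate_act, Finset.piecewise_eq_of_mem _ _ _ hD, Finset.piecewise_eq_of_mem _ _ _ hD,
      writeGate_act]
  · rw [writeGate_act, Finset.piecewise_eq_of_notMem _ _ _ hD,
      Finset.piecewise_eq_of_notMem _ _ _ hD, writeGate_act]

theorem separates_cswapGate_of_iff {D : Finset (Cell n)} {v : Node n} {b : Bool}
    (h₁ : Cell.router v .status ∈ D ↔ Cell.router v .input ∈ D)
    (h₂ : Cell.router v .input ∈ D ↔ Cell.router v (.port b) ∈ D) (c : Config n A) :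
    Separates D (cswapGate v b) c := by
  refine Or.inl fun c r => funext fun z => ?_
  have hz : Equiv.swap (Cell.router v .input) (Cell.router v (.port b)) z ∈ D ↔ z ∈ D := by
    rw [Equiv.swap_apply_def]
    split_ifs with e₁ e₂
    · rw [e₁, h₂]
    · rw [e₂, h₂]
    · rfl
  by_cases hS : Cell.router v .status ∈ D
  · by_cases hD : z ∈ D
    · rw [Finset.piecewise_eq_of_mem _ _ _ hD, cswapGate_act, cswapGate_act,
        Finset.piecewise_eq_of_mem _ _ _ hS]
      split_ifs
      · rw [swapCells_apply, Finset.piecewise_eq_of_mem _ _ _ (hz.2 hD), swapCells_apply]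
      · rw [Finset.piecewise_eq_of_mem _ _ _ hD]
    · have e₁ : z ≠ .router v .input := fun e => hD (e ▸ h₁.1 hS)
      have e₂ : z ≠ .router v (.port b) := fun e => hD (e ▸ h₂.1 (h₁.1 hS))
      rw [cswapGate_act_of_ne _ e₁ e₂, Finset.piecewise_eq_of_notMem _ _ _ hD,
        Finset.piecewise_eq_of_notMem _ _ _ hD, cswapGate_act_of_ne _ e₁ e₂]
  · by_cases hD : z ∈ D
    · have e₁ : z ≠ .router v .input := fun e => hS (h₁.2 (e ▸ hD))
      have e₂ : z ≠ .router v (.port b) := fun e => hS (h₁.2 (h₂.2 (e ▸ hD)))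
      rw [cswapGate_act_of_ne _ e₁ e₂, Finset.piecewise_eq_of_mem _ _ _ hD,
        Finset.piecewise_eq_of_mem _ _ _ hD, cswapGate_act_of_ne _ e₁ e₂]
    · rw [Finset.piecewise_eq_of_notMem _ _ _ hD, cswapGate_act, cswapGate_act,
        Finset.piecewise_eq_of_notMem _ _ _ hS]
      split_ifs
      · rw [swapCells_apply, Finset.piecewise_eq_of_notMem _ _ _ fun h => hD (hz.1 h),
          swapCells_apply]
      · rw [Finset.piecewise_eq_of_notMem _ _ _ hD]

variable [LawfulCell A]

/-- If `v` is on no path of `G`, all its cells belong to the untracked set. Otherwise status and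
input do not, and the only danger is that port `b` does. Then the gate must be off in branch `i`,
for either choice of the contents of the untracked cells. -/
theorem separates_cswapGate {G : Finset (Fin n → Bool)}
    (hG : Waits A ∨ ∀ i ∈ G, ∀ j ∈ G, i = j) {i : Fin n → Bool} (hi : i ∈ G) (v : Node n)
    (b : Bool) {c : Config n A}
    (h₁ : v = pathNode i v.1 → c (.router v .status) = CellModel.enc (i v.1))
    (h₂ : v ≠ pathNode i v.1 → Waits A → c (.router v .status) = CellModel.idle) :
    Separates (untracked G) (cswapGate v b) c := by
  have e : ∀ j, Tracked j (.router v .status) ↔ Tracked j (.router v .input) := fun j => Iff.rfl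
  by_cases hv : ∃ j ∈ G, v = pathNode j v.1
  · obtain ⟨j, hj, hvj⟩ := hv
    have hS : Cell.router v .status ∉ untracked G := fun h => mem_untracked.1 h j hj hvj
    have hI : Cell.router v .input ∉ untracked G := fun h => mem_untracked.1 h j hj hvj
    by_cases hP : Cell.router v (.port b) ∈ untracked G
    · refine Or.inr fun r => ?_
      rw [cswapGate_act, if_neg]
      rw [Finset.piecewise_eq_of_notMem _ _ _ hS]
      by_cases hvi : v = pathNode i v.1
      · rw [h₁ hvi, LawfulCell.dir_enc]
        intro hb
        exact mem_untracked.1 hP i hi ⟨hvi, Option.some_injective _ hb⟩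
      -- The router is on the path of some `j ∈ G` but not of `i`. For a single address this cannot
      -- happen; otherwise its status is waiting and routes nothing.
      · have hW : Waits A := hG.resolve_right fun h => hvi (h i hi j hj ▸ hvj)
        rw [h₂ hvi hW, hW.1]
        simp
    · exact separates_cswapGate_of_iff (iff_of_false hS hI) (iff_of_false hI hP) c
  · have hn : ∀ s, Cell.router v s ∈ untracked G := fun s =>
      mem_untracked.2 fun j hj ht => hv ⟨j, hj, ht.nearby⟩
    exact separates_cswapGate_of_iff (iff_of_true (hn _) (hn _)) (iff_of_true (hn _) (hn _)) c

end GateAction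

/-! ### Invariants of the noiseless evolution in one branch, in the style of Hoare triples. -/

section Evolution

variable {n : ℕ} {A : Type} [CellModel A]

/-- The value of item `ℓ` in the query of address `i` with the bit `y` on the bus. -/
def itemValue (i : Fin n → Bool) (y : Bool) (ℓ : ℕ) : Bool := if h : ℓ < n then i ⟨ℓ, h⟩ else y

/-- In the branch of address `i`, each item `ℓ` is where it should be at time `u ℓ`, and, for cells
with a waiting state, all other cells are unused. -/
def Holds (i : Fin n → Bool) (y : Bool) (u : ℕ → ℕ) (c : Config n A) : Prop :=
  (∀ ℓ ≤ n, c (itemAt i ℓ (u ℓ)) = CellModel.enc (itemValue i y ℓ)) ∧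
    (Waits A → ∀ q, (∀ ℓ ≤ n, itemAt i ℓ (u ℓ) ≠ q) → c q = CellModel.idle)

theorem Holds.congr {i : Fin n → Bool} {y : Bool} {u u' : ℕ → ℕ} {c : Config n A}
    (h : Holds i y u c) (hu : ∀ ℓ ≤ n, itemAt i ℓ (u ℓ) = itemAt i ℓ (u' ℓ)) :
    Holds i y u' c := by
  refine ⟨fun ℓ hℓ => ?_, fun hW q hq => h.2 hW q fun ℓ hℓ => ?_⟩
  · rw [← hu ℓ hℓ, h.1 ℓ hℓ]
  · rw [hu ℓ hℓ]
    exact hq ℓ hℓ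

theorem Holds.idle_of_not_tracked {i : Fin n → Bool} {y : Bool} {u : ℕ → ℕ} {c : Config n A}
    (h : Holds i y u c) (hW : Waits A) {q : Cell n} (hq : ¬Tracked i q) :
    c q = CellModel.idle :=
  h.2 hW q fun ℓ _ e => hq (e ▸ tracked_itemAt i ℓ _)

theorem Holds.of_trivial {i : Fin n → Bool} {y : Bool} {u : ℕ → ℕ} {c c' : Config n A}
    (h : Holds i y u c) (h₁ : ∀ q, Tracked i q → c' q = c q) (h₂ : Waits A → c' = c) :
    Holds i y u c' :=
  ⟨fun ℓ hℓ => by rw [h₁ _ (tracked_itemAt i ℓ _), h.1 ℓ hℓ], fun hW => by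
    rw [h₂ hW]
    exact h.2 hW⟩

/-- With a waiting state both cells are idle and nothing happens; for qubits the invariant says
nothing about untracked cells. -/
theorem Holds.swapCells_of_not_tracked {i : Fin n → Bool} {y : Bool} {u : ℕ → ℕ} {c : Config n A}
    (h : Holds i y u c) {p q : Cell n} (hp : ¬Tracked i p) (hq : ¬Tracked i q) :
    Holds i y u (swapCells p q c) := by
  refine h.of_trivial (fun z hz => ?_) fun hW => ?_
  · exact swapCells_apply_of_ne c (fun e => hp (e ▸ hz)) (fun e => hq (e ▸ hz))
  · exact swapCells_eq_self ((h.idle_of_not_tracked hW hp).trans (h.idle_of_not_tracked hW hq).symm)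

/-- The times `u` may mix `t` and `t + 1`, because the operations of one layer are applied one after
the other. By `itemAt_ne` no other item sits at either end of the move. -/
theorem Holds.swapCells_itemAt {i : Fin n → Bool} {y : Bool} {u : ℕ → ℕ} {c : Config n A} {t ℓ p' : ℕ}
    (h : Holds i y u c) (ht : t + 1 ≤ 7 * n - 2) (hu : ∀ ℓ, u ℓ = t ∨ u ℓ = t + 1)
    (hp' : p' = t ∨ p' = t + 1) (hℓ : ℓ ≤ n) :
    Holds i y (Function.update u ℓ p') (swapCells (itemAt i ℓ (u ℓ)) (itemAt i ℓ p') c) := by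
  have hne : ∀ ℓ' ≤ n, ℓ' ≠ ℓ → ∀ p, p = t ∨ p = t + 1 → itemAt i ℓ' (u ℓ') ≠ itemAt i ℓ p :=
    fun ℓ' hℓ' h p hp => itemAt_ne i h hℓ' hℓ ht (hu ℓ') hp
  refine ⟨fun ℓ' hℓ' => ?_, fun hW q hq => ?_⟩
  · by_cases e : ℓ' = ℓ
    · subst e
      rw [Function.update_self, swapCells_apply, Equiv.swap_apply_right, h.1 ℓ' hℓ]
    · rw [Function.update_of_ne e, swapCells_apply_of_ne c (hne ℓ' hℓ' e _ (hu ℓ))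
        (hne ℓ' hℓ' e _ hp'), h.1 ℓ' hℓ']
  · have hq₀ := hq ℓ hℓ
    rw [Function.update_self] at hq₀
    rw [swapCells_apply]
    refine h.2 hW _ fun ℓ' hℓ' e => ?_
    by_cases hqp : q = itemAt i ℓ (u ℓ)
    · rw [hqp, Equiv.swap_apply_left] at e
      by_cases e' : ℓ' = ℓ
      · rw [e'] at e
        exact hq₀ (hqp.trans e).symm
      · exact hne ℓ' hℓ' e' _ hp' e
    · rw [Equiv.swap_apply_of_ne_of_ne hqp (Ne.symm hq₀)] at e
      by_cases e' : ℓ' = ℓ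
      · rw [e'] at e
        exact hqp e.symm
      · refine hq ℓ' hℓ' ?_
        rw [Function.update_of_ne e', e]

/-- From a configuration with property `P`, the operations in `L` lead to one with property `P'`,
and each gate separates `D` from its complement. -/
def Triple (D : Finset (Cell n)) (P : Config n A → Prop) (L : List (Gate n A))
    (P' : Config n A → Prop) : Prop :=
  ∀ c, P c → Safe D L c ∧ P' (run L c)

theorem Triple.nil {D : Finset (Cell n)} {P P' : Config n A → Prop} (h : ∀ c, P c → P' c) :
    Triple D P [] P' := fun c hc => ⟨trivial, h c hc⟩

theorem Triple.single {D : Finset (Cell n)} {P P' : Config n A → Prop} {g : Gate n A}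
    (h : ∀ c, P c → Separates D g c ∧ P' (g.act c)) : Triple D P [g] P' :=
  fun c hc => ⟨⟨(h c hc).1, trivial⟩, (h c hc).2⟩

theorem Triple.append {D : Finset (Cell n)} {P P' P'' : Config n A → Prop} {L L' : List (Gate n A)}
    (h : Triple D P L P') (h' : Triple D P' L' P'') : Triple D P (L ++ L') P'' := by
  intro c hc
  obtain ⟨h₁, h₂⟩ := h c hc
  obtain ⟨h₃, h₄⟩ := h' _ h₂
  exact ⟨safe_append h₁ h₃, by rwa [run_append]⟩

theorem Triple.flatMap {D : Finset (Cell n)} {P : Config n A → Prop} {ι : Type*} {l : List ι}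
    {F : ι → List (Gate n A)} (h : ∀ v ∈ l, Triple D P (F v) P) : Triple D P (l.flatMap F) P := by
  induction l with
  | nil => exact Triple.nil fun _ h => h
  | cons v l ih =>
    rw [List.flatMap_cons]
    exact (h v List.mem_cons_self).append (ih fun w hw => h w (List.mem_cons_of_mem _ hw))

/-- One of the blocks of operations is effective and the others preserve the properties. -/
theorem Triple.flatMap_of_mem {D : Finset (Cell n)} {P P' : Config n A → Prop} {ι : Type*}
    {l : List ι} (hl : l.Nodup) {w : ι} (hw : w ∈ l) {F : ι → List (Gate n A)}
    (h : ∀ v ∈ l, v ≠ w → Triple D P (F v) P) (h' : ∀ v ∈ l, v ≠ w → Triple D P' (F v) P')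
    (hF : Triple D P (F w) P') : Triple D P (l.flatMap F) P' := by
  obtain ⟨l₁, l₂, rfl⟩ := List.append_of_mem hw
  rw [List.nodup_append] at hl
  rw [List.flatMap_append, List.flatMap_cons]
  refine Triple.append (Triple.flatMap fun v hv => h v (by simp [hv]) ?_)
    (hF.append (Triple.flatMap fun v hv => h' v (by simp [hv]) ?_))
  · rintro rfl
    exact hl.2.2 v hv v List.mem_cons_self rfl
  · rintro rfl
    exact (List.nodup_cons.1 hl.2.1).1 hv

end Evolution

/-! ### Each block of operations moves its item by one step along the path. -/

section Steps

variable {n : ℕ}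

theorem itemPos_input (i : Fin n → Bool) {ℓ j : ℕ} (h : j ≤ ℓ) :
    itemPos i ℓ (3 * j + 1) = pathCell i j .input := by
  rw [itemPos_succ, if_neg (by omega), if_pos (Or.inl (by omega)),
    show 3 * j / 3 = j by omega]

theorem itemPos_between (i : Fin n → Bool) {ℓ j : ℕ} (h : j < ℓ) :
    itemPos i ℓ (3 * j + 2) = if bitAt i j = true then pathCell i j .input
      else pathCell i j (.port false) := by
  rw [itemPos_succ, if_neg (by omega), show (3 * j + 1) / 3 = j by omega,
    show (3 * j + 1) % 3 = 1 by omega]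
  cases bitAt i j <;> simp

theorem itemPos_output (i : Fin n → Bool) {ℓ j : ℕ} (h : j < ℓ) :
    itemPos i ℓ (3 * j + 3) = pathCell i j (.port (bitAt i j)) := by
  rw [itemPos_succ, if_neg (by omega), if_neg (by omega), show (3 * j + 2) / 3 = j by omega]

theorem itemPos_status (i : Fin n → Bool) {ℓ s : ℕ} (h : ℓ < n) (hs : 3 * ℓ + 2 ≤ s) :
    itemPos i ℓ s = pathCell i ℓ .status := by
  obtain ⟨s, rfl⟩ : ∃ s', s = s' + 1 := ⟨s - 1, by omega⟩
  rw [itemPos_succ, if_pos ⟨by omega, h⟩]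

variable {A : Type} [CellModel A]

theorem itemOps_zero (ℓ : ℕ) : itemOps n A ℓ 0 = loadOps n A ℓ := rfl

theorem itemOps_route_false {ℓ j : ℕ} (h : j < ℓ) :
    itemOps n A ℓ (3 * j + 1) = routeOps n A j false := by
  rw [itemOps, if_neg (by omega), if_pos (by omega), if_pos (by omega),
    show (3 * j + 1 - 1) / 3 = j by omega]

theorem itemOps_route_true {ℓ j : ℕ} (h : j < ℓ) :
    itemOps n A ℓ (3 * j + 2) = routeOps n A j true := by
  rw [itemOps, if_neg (by omega), if_pos (by omega), if_neg (by omega), if_pos (by omega),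
    show (3 * j + 2 - 1) / 3 = j by omega]

theorem itemOps_link {ℓ j : ℕ} (h : j < ℓ) : itemOps n A ℓ (3 * j + 3) = linkOps n A j := by
  rw [itemOps, if_neg (by omega), if_pos (by omega), if_neg (by omega), if_neg (by omega),
    show (3 * j + 3 - 1) / 3 = j by omega]

theorem itemOps_set {ℓ : ℕ} (h : ℓ < n) : itemOps n A ℓ (3 * ℓ + 1) = setOps n A ℓ := by
  rw [itemOps, if_neg (by omega), if_neg (by omega), if_pos ⟨rfl, h⟩]

theorem itemOps_after {ℓ s : ℕ} (hs : 3 * ℓ + 2 ≤ s) : itemOps n A ℓ s = [] := by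
  rw [itemOps, if_neg (by omega), if_neg (by omega), if_neg (by omega)]

variable [LawfulCell A] {G : Finset (Fin n → Bool)} {i : Fin n → Bool} {y : Bool}

/-- Here `p` is the other of the two times: a swap is its own inverse, so one statement serves the
query and its reversal. If the item rests, the two positions coincide and the swap is trivial. -/
theorem triple_swap {t ℓ : ℕ} {D : Finset (Cell n)} (ht : t + 1 ≤ 7 * n - 2) (hℓ : ℓ ≤ n)
    {u : ℕ → ℕ} (hu : ∀ ℓ, u ℓ = t ∨ u ℓ = t + 1) {p : ℕ}
    (hp : u ℓ = t ∧ p = t + 1 ∨ u ℓ = t + 1 ∧ p = t) {g : Gate n A}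
    (hg : ∀ c, Holds i y u c → Separates D g c ∧
      g.act c = swapCells (itemAt i ℓ t) (itemAt i ℓ (t + 1)) c) :
    Triple D (Holds i y u) [g] (Holds i y (Function.update u ℓ p)) := by
  refine Triple.single fun c hc => ⟨(hg c hc).1, ?_⟩
  have h₃ := hc.swapCells_itemAt ht hu (p' := p) (by omega) hℓ
  rw [(hg c hc).2]
  rcases hp with ⟨e, rfl⟩ | ⟨e, rfl⟩
  · rwa [e] at h₃
  · rw [swapCells_comm]
    rwa [e] at h₃

/-- A block of operations on a level that moves item `ℓ` on the path and acts trivially elsewhere. -/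
theorem triple_move {t ℓ j : ℕ} {D : Finset (Cell n)}
    (hj : j < n) (F : Node n → List (Gate n A))
    (htriv : ∀ v ∈ levelNodes n j, v ≠ pathNode i v.1 → ∀ u : ℕ → ℕ,
      (∀ ℓ, u ℓ = t ∨ u ℓ = t + 1) → Triple D (Holds i y u) (F v) (Holds i y u))
    {u : ℕ → ℕ} (hu : ∀ ℓ, u ℓ = t ∨ u ℓ = t + 1) {p : ℕ}
    (hp : u ℓ = t ∧ p = t + 1 ∨ u ℓ = t + 1 ∧ p = t)
    (hF : Triple D (Holds i y u) (F (pathNode i ⟨j, hj⟩)) (Holds i y (Function.update u ℓ p))) :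
    Triple D (Holds i y u) ((levelNodes n j).flatMap F) (Holds i y (Function.update u ℓ p)) := by
  have hne : ∀ v ∈ levelNodes n j, v ≠ pathNode i ⟨j, hj⟩ → v ≠ pathNode i v.1 := by
    intro v hv h e
    have hv' : v.1 = ⟨j, hj⟩ := Fin.ext (mem_levelNodes.1 hv)
    rw [hv'] at e
    exact h e
  have hu' : ∀ ℓ', Function.update u ℓ p ℓ' = t ∨ Function.update u ℓ p ℓ' = t + 1 := by
    intro ℓ'
    by_cases e : ℓ' = ℓ
    · rw [e, Function.update_self]
      omega
    · rw [Function.update_of_ne e]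
      exact hu ℓ'
  exact Triple.flatMap_of_mem (Finset.nodup_toList _) (w := pathNode i ⟨j, hj⟩)
    (mem_levelNodes.2 rfl) (fun v hv h => htriv v hv (hne v hv h) u hu)
    (fun v hv h => htriv v hv (hne v hv h) _ hu') hF

theorem triple_itemOps (hG : Waits A ∨ ∀ i ∈ G, ∀ j ∈ G, i = j) (hi : i ∈ G) {t ℓ : ℕ}
    (ht : t + 1 ≤ 7 * n - 2) (hℓ : ℓ ≤ n) (hst : startTime ℓ ≤ t) {u : ℕ → ℕ}
    (hu : ∀ ℓ, u ℓ = t ∨ u ℓ = t + 1) {p : ℕ}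
    (hp : u ℓ = t ∧ p = t + 1 ∨ u ℓ = t + 1 ∧ p = t) :
    Triple (untracked G) (Holds i y u) (itemOps n A ℓ (t - startTime ℓ))
      (Holds i y (Function.update u ℓ p)) := by
  have e₁ : startTime ℓ = 4 * ℓ - 2 := rfl
  have hat : itemAt i ℓ t = itemPos i ℓ (t - startTime ℓ) := rfl
  have hat' : itemAt i ℓ (t + 1) = itemPos i ℓ (t - startTime ℓ + 1) := by
    rw [itemAt, Nat.sub_add_comm hst]
  -- the status of the routers that have been set
  have hstat : ∀ j, j < ℓ → 3 * j + 1 ≤ t - startTime ℓ → ∀ u : ℕ → ℕ,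
      (∀ ℓ, u ℓ = t ∨ u ℓ = t + 1) → ∀ c : Config n A, Holds i y u c → ∀ v ∈ levelNodes n j,
      (v = pathNode i v.1 → c (.router v .status) = CellModel.enc (i v.1)) ∧
      (v ≠ pathNode i v.1 → Waits A → c (.router v .status) = CellModel.idle) := by
    intro j hjℓ hjt u hu c hc v hv
    refine ⟨fun e => ?_, fun e hW => hc.idle_of_not_tracked hW e⟩
    have hvj := mem_levelNodes.1 hv
    have hjn : j < n := by omega
    have e₂ : startTime j = 4 * j - 2 := rfl
    have h := hc.1 j hjn.le
    -- When item `ℓ > j` is routed at level `j`, the earlier start of item `j` guarantees that it is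
    -- already stored there, in both directions of time.
    rw [itemAt, itemPos_status i hjn (by have := hu j; omega), pathCell_of_lt i hjn, itemValue,
      dif_pos hjn] at h
    have hv' : v = pathNode i ⟨j, hjn⟩ := e.trans (congrArg (pathNode i) (Fin.ext hvj))
    rw [hv']
    exact h
  -- Of the two routing steps at a level, the one with `b` equal to the address bit moves the item
  -- and the other leaves it in place.
  have hroute : ∀ j b, j < ℓ → 3 * j + 1 ≤ t - startTime ℓ →
      (b = bitAt i j → swapCells (pathCell i j .input) (pathCell i j (.port b)) =
        (swapCells (itemAt i ℓ t) (itemAt i ℓ (t + 1)) : Equiv.Perm (Config n A))) →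
      (b ≠ bitAt i j → itemAt i ℓ t = itemAt i ℓ (t + 1)) →
      Triple (untracked G) (Holds i y u) (routeOps n A j b)
        (Holds i y (Function.update u ℓ p)) := by
    intro j b hjℓ hjt h₁ h₂
    have hjn : j < n := by omega
    rw [routeOps, List.map_eq_flatMap]
    refine triple_move hjn _ (fun v hv hvi u hu => Triple.single fun c hc => ?_) hu hp
      (triple_swap ht hℓ hu hp fun c hc => ?_)
    · obtain ⟨s₁, s₂⟩ := hstat j hjℓ hjt u hu c hc v hv
      refine ⟨separates_cswapGate hG hi v b s₁ s₂, hc.of_trivial (fun q hq => ?_) fun hW => ?_⟩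
      · refine cswapGate_act_of_ne c ?_ ?_
        · rintro rfl
          exact hvi hq
        · rintro rfl
          exact hvi hq.1
      · rw [cswapGate_act, s₂ hvi hW, hW.1]
        simp
    · have hw : pathNode i ⟨j, hjn⟩ ∈ levelNodes n j := mem_levelNodes.2 rfl
      obtain ⟨s₁, s₂⟩ := hstat j hjℓ hjt u hu c hc _ hw
      refine ⟨separates_cswapGate hG hi _ b s₁ s₂, ?_⟩
      rw [cswapGate_act, s₁ rfl, LawfulCell.dir_enc]
      have hb : (pathNode i ⟨j, hjn⟩).1 = ⟨j, hjn⟩ := rfl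
      rw [hb, ← bitAt_of_lt i hjn]
      by_cases e : b = bitAt i j
      · rw [if_pos (by rw [e]), ← h₁ e, pathCell_of_lt i hjn, pathCell_of_lt i hjn]
      · rw [if_neg (fun h => e (Option.some_injective _ h).symm), h₂ e, swapCells_self]
  rcases Nat.eq_zero_or_pos (t - startTime ℓ) with hs | hs
  · rw [hs] at hat hat' ⊢
    have hn : 0 < n := by omega
    rw [itemOps_zero, loadOps, List.map_eq_flatMap]
    refine triple_move hn _
      (fun v hv hvi => absurd (eq_pathNode_of_mem_levelNodes_zero i hv) hvi) hu hp
      (triple_swap ht hℓ hu hp fun c hc => ?_)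
    have hG' : (itemHome n ℓ ∈ untracked G ↔
        Cell.router (pathNode i ⟨0, hn⟩) .input ∈ untracked G) := by
      refine iff_of_false (fun h => mem_untracked.1 h i hi ?_) fun h => mem_untracked.1 h i hi rfl
      exact tracked_itemAt i ℓ 0 |> fun h => by simpa [itemAt, itemPos_zero] using h
    refine ⟨separates_of_act_eq_swapCells rfl hG' c, ?_⟩
    rw [hat, hat', itemPos_zero, itemPos_input i (j := 0) (Nat.zero_le _), pathCell_of_lt i hn]
    rfl
  by_cases hs' : t - startTime ℓ ≤ 3 * ℓ
  · obtain ⟨j, hj⟩ : ∃ j, t - startTime ℓ = 3 * j + 1 ∨ t - startTime ℓ = 3 * j + 2 ∨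
        t - startTime ℓ = 3 * j + 3 := ⟨(t - startTime ℓ - 1) / 3, by omega⟩
    have hjℓ : j < ℓ := by omega
    have hjn : j < n := by omega
    rcases hj with hj | hj | hj
    · rw [hj] at hat hat'
      rw [itemPos_input i hjℓ.le] at hat
      rw [itemPos_between i hjℓ] at hat'
      rw [hj, itemOps_route_false hjℓ]
      refine hroute j false hjℓ hj.ge (fun e => ?_) fun e => ?_
      · rw [hat, hat', ← e]
        rfl
      · rw [hat, hat', if_pos]
        simpa using e.symm
    · rw [hj] at hat hat'
      rw [itemPos_between i hjℓ] at hat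
      rw [itemPos_output i hjℓ] at hat'
      rw [hj, itemOps_route_true hjℓ]
      refine hroute j true hjℓ (by omega) (fun e => ?_) fun e => ?_
      · rw [hat, hat', ← e]
        rfl
      · have e' : bitAt i j = false := by simpa using e.symm
        rw [hat, hat', e']
        rfl
    · rw [hj] at hat hat'
      rw [itemPos_output i hjℓ] at hat
      rw [show 3 * j + 3 + 1 = 3 * (j + 1) + 1 by ring, itemPos_input i hjℓ] at hat'
      have hj1 : j + 1 < n := by omega
      rw [hj, itemOps_link hjℓ, linkOps]
      have htriv : ∀ (v : Node n) (b : Bool) (h : (v.1 : ℕ) + 1 < n) (u : ℕ → ℕ),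
          ¬Tracked i (.router v (.port b)) →
          Triple (untracked G) (Holds i y u) [longRangeGate (A := A) v b h] (Holds i y u) := by
        intro v b h u hv
        refine Triple.single fun c hc => ⟨separates_of_act_eq_swapCells rfl ?_ c,
          hc.swapCells_of_not_tracked hv ?_⟩
        · exact mem_untracked_iff_of_tracked_iff fun j => tracked_port_iff_tracked_child j v b h
        · rwa [← tracked_port_iff_tracked_child]
      refine triple_move hjn _ (fun v hv hvi u hu => ?_) hu hp ?_
      · have h : (v.1 : ℕ) + 1 < n := by rw [mem_levelNodes.1 hv]; exact hj1
        rw [dif_pos h]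
        exact (htriv v false h u fun h => hvi h.1).append (htriv v true h u fun h => hvi h.1)
      · set w := pathNode i ⟨j, hjn⟩ with hw
        have h : (w.1 : ℕ) + 1 < n := hj1
        have hmain : ∀ b, b = bitAt i j → Triple (untracked G) (Holds i y u)
            [longRangeGate (A := A) w b h] (Holds i y (Function.update u ℓ p)) := by
          rintro b rfl
          refine triple_swap ht hℓ hu hp fun c hc =>
            ⟨separates_of_act_eq_swapCells rfl ?_ c, ?_⟩
          · exact mem_untracked_iff_of_tracked_iff fun j => tracked_port_iff_tracked_child j w _ h
          · have hch : child w (bitAt i j) h = pathNode i ⟨j + 1, hj1⟩ := by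
              rw [bitAt_of_lt i hjn]
              exact child_pathNode i ⟨j, hjn⟩ h
            rw [hat, hat', pathCell_of_lt i hjn, pathCell_of_lt i hj1]
            show swapCells _ (Cell.router (child w _ h) .input) c = _
            rw [hch]
        -- The link at the wrong output of the path router joins two cells that are untracked for
        -- `i`.
        have hoff : ∀ b, b ≠ bitAt i j → ¬Tracked i (.router w (.port b)) := by
          intro b hb hT
          rw [bitAt_of_lt i hjn] at hb
          exact hb hT.2.symm
        rw [dif_pos h]
        cases hbit : bitAt i j
        · exact (hmain false hbit.symm).append (htriv w true h _ (hoff _ (by simp [hbit])))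
        · exact (htriv w false h _ (hoff _ (by simp [hbit]))).append (hmain true hbit.symm)
  · by_cases hs'' : t - startTime ℓ = 3 * ℓ + 1
    -- The time bound excludes the bus: it has taken at most `3 n - 1` steps before time `t`.
    · have hn : ℓ < n := by omega
      rw [hs''] at hat hat' ⊢
      rw [itemPos_input i le_rfl] at hat
      rw [itemPos_status i hn le_rfl] at hat'
      rw [itemOps_set hn, setOps, List.map_eq_flatMap]
      have hiff : ∀ v : Node n, Cell.router v .input ∈ untracked G ↔
          Cell.router v .status ∈ untracked G := fun v =>
        mem_untracked_iff_of_tracked_iff fun j => Iff.rfl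
      refine triple_move hn _ (fun v hv hvi u hu => Triple.single fun c hc =>
        ⟨separates_of_act_eq_swapCells rfl (hiff v) c, ?_⟩) hu hp
        (triple_swap ht hℓ hu hp fun c hc => ⟨separates_of_act_eq_swapCells rfl (hiff _) c, ?_⟩)
      · exact hc.swapCells_of_not_tracked (p := .router v .input) (q := .router v .status) hvi hvi
      rw [hat, hat', pathCell_of_lt i hn, pathCell_of_lt i hn]
      rfl
    · have hn : ℓ < n := by omega
      rw [itemOps_after (by omega)]
      rw [itemPos_status i hn (by omega)] at hat hat'
      refine Triple.nil fun c hc => hc.congr fun ℓ' _ => ?_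
      by_cases e : ℓ' = ℓ
      · rw [e, Function.update_self]
        rcases hp with ⟨h, rfl⟩ | ⟨h, rfl⟩ <;> rw [h, hat, hat']
      · rw [Function.update_of_ne e]

end Steps

/-! ### The whole query, and the union bound over operations near the path. -/

section Query

variable {n : ℕ} {A : Type} [CellModel A] [LawfulCell A] {G : Finset (Fin n → Bool)}
  {i : Fin n → Bool} {y : Bool}

theorem itemAt_of_le (i : Fin n → Bool) {ℓ t : ℕ} (h : t ≤ startTime ℓ) :
    itemAt i ℓ t = itemHome n ℓ := by
  rw [itemAt, Nat.sub_eq_zero_of_le h, itemPos_zero]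

/-- The second half reverses the order of the layers but not the order within a layer. This does no
harm: the items move one after the other, and in either direction of time none obstructs another. -/
theorem triple_inLayer (hG : Waits A ∨ ∀ i ∈ G, ∀ j ∈ G, i = j) (hi : i ∈ G) {t p p' : ℕ}
    (ht : t + 1 ≤ 7 * n - 2) (hp : p = t ∧ p' = t + 1 ∨ p = t + 1 ∧ p' = t) :
    Triple (untracked G) (Holds i y fun _ => p) (inLayer n A t) (Holds i y fun _ => p') := by
  have key : ∀ m ≤ n + 1, Triple (untracked G) (Holds i y fun _ => p)
      ((List.range m).flatMap fun ℓ =>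
        if startTime ℓ ≤ t then itemOps n A ℓ (t - startTime ℓ) else [])
      (Holds i y fun ℓ => if ℓ < m then p' else p) := by
    intro m
    induction m with
    | zero => exact fun _ => Triple.nil fun c hc => by simpa using hc
    | succ m ih =>
      intro hm
      rw [List.range_succ, List.flatMap_append, List.flatMap_singleton]
      refine (ih (by omega)).append ?_
      have hupd : (fun ℓ => if ℓ < m + 1 then p' else p)
          = Function.update (fun ℓ => if ℓ < m then p' else p) m p' := by
        funext ℓ
        by_cases e : ℓ = m
        · subst e
          simp
        · rw [Function.update_of_ne e]
          exact if_congr (by omega) rfl rfl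
      split_ifs with hst
      · rw [hupd]
        refine triple_itemOps hG hi ht (by omega) hst (fun ℓ => ?_) (by simpa using hp)
        split_ifs <;> omega
      -- An item not yet loaded is at home at both times.
      · refine Triple.nil fun c hc => hc.congr fun ℓ _ => ?_
        by_cases e : ℓ = m
        · rw [itemAt_of_le i, itemAt_of_le i]
          · subst e
            split_ifs <;> omega
          · subst e
            split_ifs <;> omega
        · have : ℓ < m ↔ ℓ < m + 1 := by omega
          simp only [this]
  intro c hc
  obtain ⟨h₁, h₂⟩ := key (n + 1) le_rfl c hc
  exact ⟨h₁, h₂.congr fun ℓ hℓ => by rw [if_pos (by omega)]⟩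

theorem Triple.withIdle {D : Finset (Cell n)} {P P' : Config n A → Prop} {L : List (Gate n A)}
    (h : Triple D P L P') : Triple D P (withIdle n A L) P' := by
  refine h.append ?_
  rw [List.map_eq_flatMap]
  exact Triple.flatMap fun q _ => Triple.single fun c hc => ⟨separates_idleGate D q c, hc⟩

theorem triple_inLayers (hG : Waits A ∨ ∀ i ∈ G, ∀ j ∈ G, i = j) (hi : i ∈ G) {m : ℕ}
    (hm : m ≤ 7 * n - 2) :
    Triple (untracked G) (Holds i y fun _ => 0)
      (((List.range m).map (inLayer n A)).flatMap (withIdle n A)) (Holds i y fun _ => m) := by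
  induction m with
  | zero => exact Triple.nil fun c hc => hc
  | succ m ih =>
    rw [List.range_succ, List.map_append, List.flatMap_append, List.map_singleton,
      List.flatMap_singleton]
    exact (ih (by omega)).append
      (triple_inLayer hG hi hm (Or.inl ⟨rfl, rfl⟩)).withIdle

theorem triple_reverse_inLayers (hG : Waits A ∨ ∀ i ∈ G, ∀ j ∈ G, i = j) (hi : i ∈ G) {m : ℕ}
    (hm : m ≤ 7 * n - 2) :
    Triple (untracked G) (Holds i y fun _ => m)
      (((List.range m).map (inLayer n A)).reverse.flatMap (withIdle n A))
      (Holds i y fun _ => 0) := by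
  induction m with
  | zero => exact Triple.nil fun c hc => hc
  | succ m ih =>
    rw [List.range_succ, List.map_append, List.map_singleton, List.reverse_append,
      List.reverse_singleton, List.flatMap_append, List.flatMap_singleton]
    exact (triple_inLayer hG hi hm (Or.inr ⟨rfl, rfl⟩)).withIdle.append (ih (by omega))

theorem leafAddress_pathNode (i : Fin n → Bool) (hn : n - 1 < n) :
    leafAddress (pathNode i ⟨n - 1, hn⟩) (i ⟨n - 1, hn⟩) = i := by
  funext j
  unfold leafAddress
  split_ifs with h
  · rfl
  · have h' : ¬(j : ℕ) < n - 1 := h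
    congr 1
    exact Fin.ext (by have := j.2; simp only; omega)

theorem triple_writeGate_of_not_tracked {D : Finset (Cell n)} {x : (Fin n → Bool) → Bool}
    {u : ℕ → ℕ} {v : Node n} {b : Bool} (h : ¬Tracked i (.router v (.port b))) :
    Triple D (Holds i y u) [writeGate (A := A) x v b] (Holds i y u) := by
  refine Triple.single fun c hc => ⟨separates_writeGate D x v b c,
    hc.of_trivial (fun q hq => ?_) fun hW => funext fun q => ?_⟩
  · rw [writeGate_act, if_neg]
    rintro ⟨rfl, -⟩
    exact h hq
  · rw [writeGate_act]
    split_ifs with hq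
    · rw [hq.1, hc.idle_of_not_tracked hW h, hW.2]
    · rfl

/-- Writing acts cell by cell, so the separation holds for any `D`. Only the output that holds the
bus matters: in the waiting case `X` fixes the others. -/
theorem triple_writeLayer {D : Finset (Cell n)} (hn : 1 ≤ n) (x : (Fin n → Bool) → Bool) :
    Triple D (Holds i false fun _ => 7 * n - 2) (writeLayer n A x)
      (Holds i (x i) fun _ => 7 * n - 2) := by
  have hn' : n - 1 < n := by omega
  set w := pathNode i ⟨n - 1, hn'⟩ with hw
  have hpos : itemAt i n (7 * n - 2) = .router w (.port (i ⟨n - 1, hn'⟩)) := by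
    -- At the end of the first half the bus has taken exactly `3 n` steps and has just reached an
    -- output of the last level.
    have h : 7 * n - 2 - startTime n = 3 * (n - 1) + 3 := by
      have : startTime n = 4 * n - 2 := rfl
      omega
    rw [itemAt, h, itemPos_output i hn', pathCell_of_lt i hn', bitAt_of_lt i hn']
  have hmain : ∀ b, b = i ⟨n - 1, hn'⟩ → Triple D (Holds i false fun _ => 7 * n - 2)
      [writeGate (A := A) x w b] (Holds i (x i) fun _ => 7 * n - 2) := by
    rintro b rfl
    refine Triple.single fun c hc => ⟨separates_writeGate D x w _ c, fun ℓ hℓ => ?_, ?_⟩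
    · rw [writeGate_act, leafAddress_pathNode, ← hpos]
      by_cases e : ℓ = n
      · subst e
        have h := hc.1 ℓ le_rfl
        simp only [itemValue, lt_irrefl, dif_neg, not_false_eq_true, true_and] at h ⊢
        rw [h]
        cases x i
        · rfl
        · simp [LawfulCell.flip_enc]
      · have hne := itemAt_ne i (t := 7 * n - 2 - 1) (u := 7 * n - 2) (u' := 7 * n - 2) e hℓ le_rfl
          (by omega) (by omega) (by omega)
        rw [if_neg fun h => hne h.1, hc.1 ℓ hℓ, itemValue, itemValue, dif_pos (by omega),
          dif_pos (by omega)]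
    · intro hW q hq
      rw [writeGate_act, ← hpos, if_neg fun h => hq n le_rfl h.1.symm]
      exact hc.2 hW q hq
  have hoff : ∀ b, b ≠ i ⟨n - 1, hn'⟩ → ¬Tracked i (.router w (.port b)) :=
    fun b hb h => hb h.2.symm
  have hne : ∀ v ∈ levelNodes n (n - 1), v ≠ w → ∀ b, ¬Tracked i (.router v (.port b)) := by
    intro v hv h b e
    have hv' : v.1 = ⟨n - 1, hn'⟩ := Fin.ext (mem_levelNodes.1 hv)
    exact h (e.1.trans (congrArg (pathNode i) hv'))
  refine Triple.flatMap_of_mem (Finset.nodup_toList _) (w := w) (mem_levelNodes.2 rfl)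
    (fun v hv h => ?_) (fun v hv h => ?_) ?_
  · exact (triple_writeGate_of_not_tracked (hne v hv h _)).append
      (triple_writeGate_of_not_tracked (hne v hv h _))
  · exact (triple_writeGate_of_not_tracked (hne v hv h _)).append
      (triple_writeGate_of_not_tracked (hne v hv h _))
  · cases hbit : i ⟨n - 1, hn'⟩
    · exact (hmain false hbit.symm).append
        (triple_writeGate_of_not_tracked (hoff _ (by simp [hbit])))
    · exact Triple.append (triple_writeGate_of_not_tracked (hoff _ (by simp [hbit])))
        (hmain true hbit.symm)

theorem triple_operations (hn : 1 ≤ n) (hG : Waits A ∨ ∀ i ∈ G, ∀ j ∈ G, i = j) (hi : i ∈ G)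
    (x : (Fin n → Bool) → Bool) :
    Triple (untracked G) (Holds i false fun _ => 0) (operations n A x)
      (Holds i (x i) fun _ => 0) := by
  rw [operations, layers, List.flatMap_append, List.flatMap_append, List.flatMap_singleton]
  exact ((triple_inLayers hG hi le_rfl).append (triple_writeLayer hn x).withIdle).append
    (triple_reverse_inLayers hG hi le_rfl)

/-- At time `0` all items are at home, so this describes both the input and the output of the query.
-/
theorem holds_zero_iff {c : Config n A} :
    Holds i y (fun _ => 0) c ↔ (∀ ℓ, c (.addr ℓ) = CellModel.enc (i ℓ)) ∧
      c .bus = CellModel.enc y ∧ (Waits A → ∀ v s, c (.router v s) = CellModel.idle) := by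
  have hbus : itemHome n n = .bus := dif_neg (lt_irrefl n)
  constructor
  · rintro ⟨h₁, h₂⟩
    refine ⟨fun ℓ => ?_, ?_, fun hW v s => h₂ hW _ fun ℓ hℓ => ?_⟩
    · have := h₁ ℓ ℓ.2.le
      rw [itemAt_of_le i (Nat.zero_le _), itemHome, dif_pos ℓ.2, itemValue, dif_pos ℓ.2] at this
      exact this
    · have := h₁ n le_rfl
      rw [itemAt_of_le i (Nat.zero_le _), hbus, itemValue, dif_neg (lt_irrefl n)] at this
      exact this
    · rw [itemAt_of_le i (Nat.zero_le _), itemHome]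
      split_ifs <;> simp
  · rintro ⟨h₁, h₂, h₃⟩
    refine ⟨fun ℓ hℓ => ?_, fun hW q hq => ?_⟩
    · rw [itemAt_of_le i (Nat.zero_le _), itemHome, itemValue]
      split_ifs with h
      · exact h₁ ⟨ℓ, h⟩
      · exact h₂
    · cases q with
      | addr ℓ =>
        refine absurd ?_ (hq ℓ ℓ.2.le)
        rw [itemAt_of_le i (Nat.zero_le _), itemHome, dif_pos ℓ.2]
      | bus => exact absurd (by rw [itemAt_of_le i (Nat.zero_le _), hbus]) (hq n le_rfl)
      | router v s => exact h₃ hW v s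

variable [Fintype A] [DecidableEq A]

/-- An operation acts on one of the cells near the path to address `i`. -/
def Touches (i : Fin n → Bool) (g : Gate n A) : Prop := ∃ q ∈ g.support, Nearby i q

open Classical in
/-- The infidelity is bounded by the average over the addresses of the total fault probability of
the operations near the path, for cells with a waiting state or for a single address. -/
theorem infidelity_le_sum_touches (hn : 1 ≤ n) (k : ℕ) (x : (Fin n → Bool) → Bool) (ε : ErrorRates)
    (hp : ∀ o, 0 ≤ faultProb k ε o) (hp' : ∀ o, faultProb k ε o ≤ 1) (E : FaultModel n A)
    (α : (Fin n → Bool) → ℂ) (hα : ∑ i, ‖α i‖ ^ 2 = 1)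
    (hA : Waits A ∨ ∀ i j, α i ≠ 0 → α j ≠ 0 → i = j) :
    infidelity k x ε E α ≤ 4 * ∑ i, ‖α i‖ ^ 2 *
      ((operations n A x).map fun g => if Touches i g then faultProb k ε g.kind else 0).sum := by
  refine infidelity_le_of_histories k x ε E α hp hp' Touches fun M hM => ?_
  -- Discarding addresses of amplitude zero costs no weight and leaves at most one element in the
  -- single-address case.
  set G : Finset (Fin n → Bool) := Finset.univ.filter fun i =>
    α i ≠ 0 ∧ ¬∃ m ∈ M, m.2 = true ∧ Touches i m.1.1 with hGdef
  have hG : Waits A ∨ ∀ i ∈ G, ∀ j ∈ G, i = j := hA.imp_right fun h i hi j hj =>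
    h i j (Finset.mem_filter.1 hi).2.1 (Finset.mem_filter.1 hj).2.1
  have hops : M.map (fun m => m.1.1) = operations n A x := by
    rw [← List.zipIdx_map_fst 0 (operations n A x), ← hM, List.map_map]
    rfl
  have hsum : ∑ i ∈ Gᶜ, ‖α i‖ ^ 2
      = ∑ i, ‖α i‖ ^ 2 * if ∃ m ∈ M, m.2 = true ∧ Touches i m.1.1 then 1 else 0 := by
    rw [← Finset.sum_subset (Finset.subset_univ Gᶜ)]
    · refine Finset.sum_congr rfl fun i hi => ?_
      by_cases h : ∃ m ∈ M, m.2 = true ∧ Touches i m.1.1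
      · rw [if_pos h, mul_one]
      · have : α i = 0 := by
          by_contra h0
          exact Finset.mem_compl.1 hi (Finset.mem_filter.2 ⟨Finset.mem_univ _, h0, h⟩)
        rw [this]
        simp
    · intro i _ hi
      rw [Finset.mem_compl, not_not] at hi
      rw [if_neg (Finset.mem_filter.1 hi).2.2, mul_zero]
  rw [← hsum]
  have hfault : ∀ m ∈ M, m.2 = true → m.1.1.support ⊆ untracked G := by
    intro m hm hm2 q hq
    refine mem_untracked.2 fun j hj ht => (Finset.mem_filter.1 hj).2.2 ⟨m, hm, hm2, q, hq, ht.nearby⟩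
  obtain ⟨ι, hι, T, hT₁, hT₂, hT₃⟩ := exists_kraus_history E (untracked G) M hfault G
  rw [hT₁]
  refine infidelity_kraus_le x hα T hT₂ G fun a => ?_
  have haddr : ∀ i ∈ G, ∀ ℓ, Cell.addr ℓ ∉ untracked G := fun i hi ℓ h =>
    mem_untracked.1 h i hi trivial
  have hbus : ∀ i ∈ G, Cell.bus ∉ untracked G := fun i hi h => mem_untracked.1 h i hi trivial
  set c : (Fin n → Bool) → Config n A := fun i => assemble i false fun _ => CellModel.idle with hc
  -- Initially the common vector on the untracked cells is the all-idle state; address and bus cells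
  -- are tracked.
  have hinit : ∀ i ∈ G, Splits (untracked G) (initialBasis A i) (c i)
      fun r => if ∀ q ∈ untracked G, r q = CellModel.idle then 1 else 0 := by
    intro i hi
    have hci : ∀ q ∈ untracked G, c i q = CellModel.idle := by
      intro q hq
      match q, hq with
      | .addr ℓ, hq => exact absurd hq (haddr i hi ℓ)
      | .bus, hq => exact absurd hq (hbus i hi)
      | .router v s, _ => rfl
    refine ⟨fun r => ?_, fun d ⟨q, _, hd⟩ => ?_⟩
    · rw [initialBasis, Pi.single_apply]
      refine if_congr ⟨fun h q hq => ?_, fun h => funext fun q => ?_⟩ rfl rfl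
      · exact (Finset.piecewise_eq_of_mem _ _ _ hq).symm.trans ((congrFun h q).trans (hci q hq))
      · by_cases hq : q ∈ untracked G
        · rw [Finset.piecewise_eq_of_mem _ _ _ hq, h q hq]
          exact (hci q hq).symm
        · rw [Finset.piecewise_eq_of_notMem _ _ _ hq]
    · rw [initialBasis, Pi.single_apply, if_neg]
      rintro rfl
      exact hd rfl
  have htriple : ∀ i ∈ G, Safe (untracked G) (operations n A x) (c i) ∧
      Holds i (x i) (fun _ => 0) (run (operations n A x) (c i)) := fun i hi =>
    triple_operations hn hG hi x (c i) (holds_zero_iff.2 ⟨fun _ => rfl, rfl, fun _ _ _ => rfl⟩)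
  obtain ⟨χ, hχ⟩ := hT₃ (initialBasis A) c _ hinit
    (fun i hi => by rw [hops]; exact (htriple i hi).1) a
  rw [hops] at hχ
  have hout : ∀ i ∈ G, ∀ d, (∀ r, d ≠ assemble i (x i) r) → (T a *ᵥ initialBasis A i) d = 0 := by
    intro i hi d hd
    obtain ⟨h₁, h₂, -⟩ := holds_zero_iff.1 (htriple i hi).2
    refine (hχ i hi).2 d (by_contra fun h => hd (fun p => d (.router p.1 p.2)) ?_)
    push Not at h
    funext q
    cases q with
    | addr ℓ => rw [h _ (haddr i hi ℓ), h₁]; rfl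
    | bus => rw [h _ (hbus i hi), h₂]; rfl
    | router v s => rfl
  rcases hG with hW | hG
  -- The common router state is `χ` on the untracked cells and idle elsewhere. The address and bus
  -- passed to `χ` are dummies, as it depends only on untracked cells.
  · refine ⟨fun r => if ∀ v s, Cell.router v s ∉ untracked G → r (v, s) = CellModel.idle then
      χ (assemble (fun _ => false) false r) else 0, fun i hi => ⟨fun r => ?_, hout i hi⟩⟩
    obtain ⟨h₁, h₂, h₃⟩ := holds_zero_iff.1 (htriple i hi).2
    beta_reduce
    split_ifs with hr
    · rw [← (hχ i hi).1]
      congr 1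
      funext q
      cases q with
      | addr ℓ => rw [Finset.piecewise_eq_of_notMem _ _ _ (haddr i hi ℓ), h₁]; rfl
      | bus => rw [Finset.piecewise_eq_of_notMem _ _ _ (hbus i hi), h₂]; rfl
      | router v s =>
        by_cases hq : Cell.router v s ∈ untracked G
        · rw [Finset.piecewise_eq_of_mem _ _ _ hq]; rfl
        · rw [Finset.piecewise_eq_of_notMem _ _ _ hq, h₃ hW, ← hr v s hq]; rfl
    · push Not at hr
      obtain ⟨v, s, hq, hr⟩ := hr
      refine (hχ i hi).2 _ ⟨_, hq, ?_⟩
      rw [h₃ hW]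
      exact hr
  · rcases G.eq_empty_or_nonempty with hGe | ⟨i₀, hi₀⟩
    · exact ⟨0, fun i hi => by simp [hGe] at hi⟩
    -- With a single branch no agreement between branches is required, so its own router amplitudes
    -- serve.
    · refine ⟨fun r => (T a *ᵥ initialBasis A i₀) (assemble i₀ (x i₀) r),
        fun i hi => ⟨fun r => ?_, hout i hi⟩⟩
      rw [hG i hi i₀ hi₀]

end Query

/-! ### Lengths of the links in the H-tree. -/

section LinkLength

variable {n : ℕ}

theorem centre_child (v : Node n) (b : Bool) (h : (v.1 : ℕ) + 1 < n) :
    centre (child v b h) = centre v + spacing n v.1 • step v.1 b := by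
  show ∑ j : Fin ((v.1 : ℕ) + 1), spacing n j • step j
    (if hj : (j : ℕ) < (v.1 : ℕ) then v.2 ⟨j, hj⟩ else b) = _
  rw [Fin.sum_univ_castSucc]
  simp [centre]

/-- The output lies one grid step from the router's centre towards the child; counting both ends
restores this step, so the length equals the spacing. -/
theorem linkLength_eq (v : Node n) (b : Bool) (h : (v.1 : ℕ) + 1 < n) :
    linkLength v b h = 2 ^ ((n - v.1) / 2) := by
  have hs : (1 : ℤ) ≤ 2 ^ ((n - v.1) / 2) := one_le_pow₀ (by norm_num)
  have h' : ((linkLength v b h : ℕ) : ℤ) = ((2 ^ ((n - v.1) / 2) : ℕ) : ℤ) := by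
    simp only [linkLength, position, centre_child, spacing, step]
    push_cast
    generalize (2 : ℤ) ^ ((n - v.1) / 2) = s at hs
    split_ifs <;> simp <;>
      first
      | rw [abs_of_nonpos (by omega)]; ring
      | rw [abs_of_nonneg (by omega)]; ring
  exact_mod_cast h'

end LinkLength

/-! ### Total fault probability of the operations near one path. -/

section Cost

theorem faultProb_nonneg (k : ℕ) {ε : ErrorRates} (hε : ε.Valid) (o : OpKind) :
    0 ≤ faultProb k ε o := by
  obtain ⟨⟨h₁, -⟩, ⟨h₂, h₂'⟩, ⟨h₃, -⟩, ⟨h₄, -⟩⟩ := hε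
  cases o with
  | idle => exact h₁
  | swap => exact h₃
  | cswap => exact h₄
  | longRange ℓ m =>
    rw [faultProb]
    split_ifs
    · exact le_rfl
    · exact sub_nonneg.2 (pow_le_one₀ (by linarith) (by linarith))

theorem faultProb_le_one (k : ℕ) {ε : ErrorRates} (hε : ε.Valid) (o : OpKind) :
    faultProb k ε o ≤ 1 := by
  obtain ⟨⟨-, h₁⟩, ⟨h₂, h₂'⟩, ⟨-, h₃⟩, ⟨-, h₄⟩⟩ := hε
  cases o with
  | idle => exact h₁
  | swap => exact h₃
  | cswap => exact h₄
  | longRange ℓ m =>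
    rw [faultProb]
    split_ifs
    · exact zero_le_one
    · exact sub_le_self _ (pow_nonneg (by linarith) _)

variable {n : ℕ} {A : Type}

open Classical in
/-- The total fault probability of those operations in a list that touch the path to `i`. -/
def pathCost (i : Fin n → Bool) (k : ℕ) (ε : ErrorRates) (L : List (Gate n A)) : ℝ :=
  (L.map fun g => if Touches i g then faultProb k ε g.kind else 0).sum

variable {i : Fin n → Bool} {k : ℕ} {ε : ErrorRates}

theorem pathCost_nil : pathCost i k ε ([] : List (Gate n A)) = 0 := rfl

theorem pathCost_append (L L' : List (Gate n A)) :
    pathCost i k ε (L ++ L') = pathCost i k ε L + pathCost i k ε L' := by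
  simp [pathCost]

theorem pathCost_cons (g : Gate n A) (L : List (Gate n A)) :
    pathCost i k ε (g :: L) = pathCost i k ε [g] + pathCost i k ε L :=
  pathCost_append [g] L

theorem pathCost_singleton_le (hε : ε.Valid) (g : Gate n A) :
    pathCost i k ε [g] ≤ faultProb k ε g.kind := by
  simp only [pathCost, List.map_singleton, List.sum_singleton]
  split_ifs
  · exact le_rfl
  · exact faultProb_nonneg k hε _

theorem pathCost_singleton_of_not_touches {g : Gate n A} (h : ¬Touches i g) :
    pathCost i k ε [g] = 0 := by
  simp [pathCost, h]

theorem pathCost_flatMap {ι : Type*} (l : List ι) (F : ι → List (Gate n A)) :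
    pathCost i k ε (l.flatMap F) = (l.map fun v => pathCost i k ε (F v)).sum := by
  induction l with
  | nil => rfl
  | cons v l ih => rw [List.flatMap_cons, pathCost_append, ih, List.map_cons, List.sum_cons]

theorem pathCost_nonneg (hε : ε.Valid) (L : List (Gate n A)) : 0 ≤ pathCost i k ε L := by
  refine List.sum_nonneg fun a ha => ?_
  obtain ⟨g, -, rfl⟩ := List.mem_map.1 ha
  split_ifs
  · exact faultProb_nonneg k hε _
  · exact le_rfl

/-- Exactly one router of each level `j < n` lies on the path, so the exponentially many others cost
nothing. -/
theorem pathCost_levelNodes_le {j : ℕ} {F : Node n → List (Gate n A)} {B : ℝ} (hB : 0 ≤ B)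
    (h₁ : ∀ v ∈ levelNodes n j, v ≠ pathNode i v.1 → pathCost i k ε (F v) = 0)
    (h₂ : ∀ v ∈ levelNodes n j, pathCost i k ε (F v) ≤ B) :
    pathCost i k ε ((levelNodes n j).flatMap F) ≤ B := by
  rw [pathCost_flatMap, levelNodes, Finset.sum_map_toList]
  by_cases hj : j < n
  · rw [Finset.sum_eq_single (pathNode i ⟨j, hj⟩)]
    · exact h₂ _ (mem_levelNodes.2 rfl)
    · intro v hv hne
      have hvj : (v.1 : ℕ) = j := (Finset.mem_filter.1 hv).2
      refine h₁ v (mem_levelNodes.2 hvj) fun e => hne ?_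
      exact e.trans (congrArg (pathNode i) (Fin.ext hvj))
    · intro h
      refine absurd ?_ h
      simp [pathNode]
  · rw [Finset.sum_eq_zero]
    · exact hB
    · intro v hv
      exact absurd ((Finset.mem_filter.1 hv).2 ▸ v.1.2) hj

variable [CellModel A]

theorem pathCost_loadOps_le (hε : ε.Valid) (ℓ : ℕ) : pathCost i k ε (loadOps n A ℓ) ≤ ε.εs := by
  rw [loadOps, List.map_eq_flatMap]
  exact pathCost_levelNodes_le hε.2.2.1.1
    (fun v hv h => absurd (eq_pathNode_of_mem_levelNodes_zero i hv) h)
    fun v _ => pathCost_singleton_le hε _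

theorem pathCost_routeOps_le (hε : ε.Valid) (j : ℕ) (b : Bool) :
    pathCost i k ε (routeOps n A j b) ≤ ε.εcs := by
  rw [routeOps, List.map_eq_flatMap]
  refine pathCost_levelNodes_le hε.2.2.2.1
    (fun v hv h => pathCost_singleton_of_not_touches ?_) fun v _ => pathCost_singleton_le hε _
  rintro ⟨q, hq, hN⟩
  simp only [cswapGate, Finset.mem_insert, Finset.mem_singleton] at hq
  rcases hq with rfl | rfl | rfl <;> exact h hN

theorem pathCost_setOps_le (hε : ε.Valid) (j : ℕ) : pathCost i k ε (setOps n A j) ≤ ε.εs := by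
  rw [setOps, List.map_eq_flatMap]
  refine pathCost_levelNodes_le hε.2.2.1.1
    (fun v hv h => pathCost_singleton_of_not_touches ?_) fun v _ => pathCost_singleton_le hε _
  rintro ⟨q, hq, hN⟩
  simp only [swapGate, Finset.mem_insert, Finset.mem_singleton] at hq
  rcases hq with rfl | rfl <;> exact h hN

/-- The fault probability of a long-range SWAP between the levels `j` and `j + 1`. -/
def linkProb (n k : ℕ) (ε : ErrorRates) (j : ℕ) : ℝ :=
  faultProb k ε (.longRange (j + 1) (2 ^ ((n - j) / 2)))

/-- Both links of the path router are charged, since `Nearby` includes its off-path output. No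
further link counts: a child on the path has its parent on the path. -/
theorem pathCost_linkOps_le (hε : ε.Valid) (j : ℕ) :
    pathCost i k ε (linkOps n A j) ≤ 2 * linkProb n k ε j := by
  have h0 : 0 ≤ 2 * linkProb n k ε j := mul_nonneg zero_le_two (faultProb_nonneg k hε _)
  rw [linkOps]
  refine pathCost_levelNodes_le h0 (fun v hv h => ?_) fun v hv => ?_
  · split_ifs with hn
    · have hoff : ∀ b, pathCost i k ε [longRangeGate (A := A) v b hn] = 0 := by
        refine fun b => pathCost_singleton_of_not_touches ?_
        rintro ⟨q, hq, hN⟩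
        simp only [longRangeGate, Finset.mem_insert, Finset.mem_singleton] at hq
        rcases hq with rfl | rfl
        · exact h hN
        · exact h ((child_eq_pathNode_iff i v b hn).1 hN).1
      rw [pathCost_cons, hoff, hoff, add_zero]
    · rfl
  · split_ifs with hn
    · have hle : ∀ b, pathCost i k ε [longRangeGate (A := A) v b hn] ≤ linkProb n k ε j := by
        intro b
        refine (pathCost_singleton_le hε _).trans (le_of_eq ?_)
        rw [longRangeGate, linkLength_eq, mem_levelNodes.1 hv, linkProb]
      rw [pathCost_cons]
      linarith [hle false, hle true]
    · exact h0

theorem pathCost_writeLayer_le (hε : ε.Valid) (x : (Fin n → Bool) → Bool) :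
    pathCost i k ε (writeLayer n A x) ≤ 2 * ε.εI := by
  rw [writeLayer]
  refine pathCost_levelNodes_le (mul_nonneg zero_le_two hε.1.1) (fun v hv h => ?_) fun v _ => ?_
  · have hoff : ∀ b, pathCost i k ε [writeGate (A := A) x v b] = 0 := by
      refine fun b => pathCost_singleton_of_not_touches ?_
      rintro ⟨q, hq, hN⟩
      simp only [writeGate, Finset.mem_singleton] at hq
      subst hq
      exact h hN
    rw [pathCost_cons, hoff, hoff, add_zero]
  · have hle : ∀ b, pathCost i k ε [writeGate (A := A) x v b] ≤ ε.εI := fun b =>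
      pathCost_singleton_le hε _
    rw [pathCost_cons]
    linarith [hle false, hle true]

theorem card_nearby_le (i : Fin n → Bool) :
    (Finset.univ.filter (Nearby i)).card ≤ 5 * n + 1 := by
  let f : Option (Fin n ⊕ Fin n × Site) → Cell n := fun z => match z with
    | none => .bus
    | some (.inl ℓ) => .addr ℓ
    | some (.inr (ℓ, s)) => .router (pathNode i ℓ) s
  have h : Finset.univ.filter (Nearby i) ⊆ Finset.univ.image f := by
    intro q hq
    have hq' := (Finset.mem_filter.1 hq).2
    refine Finset.mem_image.2 ?_
    cases q with
    | addr ℓ => exact ⟨some (.inl ℓ), Finset.mem_univ _, rfl⟩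
    | bus => exact ⟨none, Finset.mem_univ _, rfl⟩
    | router v s => exact ⟨some (.inr (v.1, s)), Finset.mem_univ _, by
        rw [show v = pathNode i v.1 from hq']; rfl⟩
  refine (Finset.card_le_card h).trans (Finset.card_image_le.trans (le_of_eq ?_))
  rw [Finset.card_univ, Fintype.card_option, Fintype.card_sum, Fintype.card_prod, Fintype.card_fin,
    show Fintype.card Site = 4 from rfl]
  ring

theorem pathCost_withIdle_le (hε : ε.Valid) (L : List (Gate n A)) :
    pathCost i k ε (withIdle n A L) ≤ pathCost i k ε L + (5 * n + 1) * ε.εI := by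
  rw [withIdle, pathCost_append]
  refine add_le_add le_rfl ?_
  rw [List.map_eq_flatMap, pathCost_flatMap, Finset.sum_map_toList]
  calc _ ≤ ∑ q, if Nearby i q then ε.εI else 0 := by
        refine (Finset.sum_le_sum_of_subset_of_nonneg (Finset.subset_univ _)
          fun q _ _ => pathCost_nonneg hε _).trans (Finset.sum_le_sum fun q _ => ?_)
        split_ifs with hq
        · exact pathCost_singleton_le hε _
        · refine (pathCost_singleton_of_not_touches ?_).le
          rintro ⟨q', hq', hN⟩
          rw [idleGate, Finset.mem_singleton] at hq'
          exact hq (hq' ▸ hN)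
    _ = (Finset.univ.filter (Nearby i)).card * ε.εI := by
        rw [← Finset.sum_filter, Finset.sum_const, nsmul_eq_mul]
    _ ≤ (5 * n + 1) * ε.εI := by
        refine mul_le_mul_of_nonneg_right ?_ hε.1.1
        exact_mod_cast card_nearby_le i

/-- The indicators ensure that, after summation over `s`, loading, storing and each link are paid
once per item. Charging a CSWAP in every step is wasteful only by a constant factor. -/
theorem pathCost_itemOps_le (hε : ε.Valid) {ℓ : ℕ} (hℓ : ℓ ≤ n) (s : ℕ) :
    pathCost i k ε (itemOps n A ℓ s) ≤ (if s = 0 then ε.εs else 0)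
      + (if s = 3 * ℓ + 1 then ε.εs else 0) + ε.εcs
      + ∑ j ∈ Finset.range n, if s = 3 * j + 3 then 2 * linkProb n k ε j else 0 := by
  have hs := hε.2.2.1.1
  have hcs := hε.2.2.2.1
  have hl : ∀ j, 0 ≤ 2 * linkProb n k ε j := fun j =>
    mul_nonneg zero_le_two (faultProb_nonneg k hε _)
  have hsum : 0 ≤ ∑ j ∈ Finset.range n, if s = 3 * j + 3 then 2 * linkProb n k ε j else 0 :=
    Finset.sum_nonneg fun j _ => by split_ifs; exacts [hl j, le_rfl]
  have h₁ : 0 ≤ if s = 0 then ε.εs else 0 := by split_ifs <;> linarith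
  have h₂ : 0 ≤ if s = 3 * ℓ + 1 then ε.εs else 0 := by split_ifs <;> linarith
  rcases Nat.eq_zero_or_pos s with h | h
  · subst h
    rw [itemOps_zero, if_pos rfl]
    linarith [pathCost_loadOps_le (A := A) (i := i) (k := k) hε ℓ]
  by_cases h' : s ≤ 3 * ℓ
  · obtain ⟨j, hj⟩ : ∃ j, s = 3 * j + 1 ∨ s = 3 * j + 2 ∨ s = 3 * j + 3 :=
      ⟨(s - 1) / 3, by omega⟩
    have hjℓ : j < ℓ := by omega
    rcases hj with rfl | rfl | rfl
    · rw [itemOps_route_false hjℓ]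
      linarith [pathCost_routeOps_le (A := A) (i := i) (k := k) hε j false]
    · rw [itemOps_route_true hjℓ]
      linarith [pathCost_routeOps_le (A := A) (i := i) (k := k) hε j true]
    · rw [itemOps_link hjℓ]
      have := Finset.single_le_sum (s := Finset.range n)
        (f := fun j' => if 3 * j + 3 = 3 * j' + 3 then 2 * linkProb n k ε j' else 0)
        (fun j' _ => by split_ifs; exacts [hl j', le_rfl]) (a := j)
        (Finset.mem_range.2 (by omega))
      rw [if_pos rfl] at this
      linarith [pathCost_linkOps_le (A := A) (i := i) (k := k) hε j]
  · by_cases h'' : s = 3 * ℓ + 1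
    · rw [if_pos h'']
      subst h''
      by_cases hn : ℓ < n
      · rw [itemOps_set hn]
        linarith [pathCost_setOps_le (A := A) (i := i) (k := k) hε ℓ]
      · rw [itemOps, if_neg (by omega), if_neg (by omega), if_neg (by omega), pathCost_nil]
        linarith
    · rw [itemOps_after (by omega), pathCost_nil]
      linarith

theorem sum_shift_le {f : ℕ → ℝ} (hf : ∀ s, 0 ≤ f s) (a T : ℕ) :
    ∑ t ∈ Finset.range T, (if a ≤ t then f (t - a) else 0) ≤ ∑ s ∈ Finset.range T, f s := by
  rw [← Finset.sum_filter, ← Finset.sum_image (f := f) (g := fun t => t - a)]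
  · refine Finset.sum_le_sum_of_subset_of_nonneg (fun s hs => ?_) fun s _ _ => hf s
    obtain ⟨t, ht, rfl⟩ := Finset.mem_image.1 hs
    have := Finset.mem_range.1 (Finset.mem_filter.1 ht).1
    exact Finset.mem_range.2 (by omega)
  · intro t ht t' ht' h
    have h₁ : a ≤ t := (Finset.mem_filter.1 ht).2
    have h₂ : a ≤ t' := (Finset.mem_filter.1 ht').2
    simp only at h
    omega

theorem sum_pathCost_itemOps_le (hε : ε.Valid) {ℓ : ℕ} (hℓ : ℓ ≤ n) (T : ℕ) :
    ∑ s ∈ Finset.range T, pathCost i k ε (itemOps n A ℓ s)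
      ≤ 2 * ε.εs + T * ε.εcs + 2 * ∑ j ∈ Finset.range n, linkProb n k ε j := by
  have hs := hε.2.2.1.1
  have hite : ∀ (a : ℕ) (B : ℝ), 0 ≤ B → ∑ s ∈ Finset.range T, (if s = a then B else 0) ≤ B := by
    intro a B hB
    rw [Finset.sum_ite_eq']
    split_ifs <;> linarith
  refine (Finset.sum_le_sum fun s _ => pathCost_itemOps_le hε hℓ s).trans ?_
  rw [Finset.sum_add_distrib, Finset.sum_add_distrib, Finset.sum_add_distrib, Finset.sum_comm,
    Finset.sum_const, Finset.card_range, nsmul_eq_mul, Finset.mul_sum]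
  have h₁ := hite 0 _ hs
  have h₂ := hite (3 * ℓ + 1) _ hs
  have h₃ : ∑ j ∈ Finset.range n, ∑ s ∈ Finset.range T,
      (if s = 3 * j + 3 then 2 * linkProb n k ε j else 0)
      ≤ ∑ j ∈ Finset.range n, 2 * linkProb n k ε j :=
    Finset.sum_le_sum fun j _ => hite _ _ (mul_nonneg zero_le_two (faultProb_nonneg k hε _))
  linarith

theorem sum_map_list_range (f : ℕ → ℝ) (m : ℕ) :
    ((List.range m).map f).sum = ∑ t ∈ Finset.range m, f t := by
  induction m with
  | zero => rfl
  | succ m ih => simp [List.range_succ, Finset.sum_range_succ, ih]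

theorem sum_pathCost_inLayer_le (hε : ε.Valid) (T : ℕ) :
    ∑ t ∈ Finset.range T, pathCost i k ε (inLayer n A t)
      ≤ (n + 1) * (2 * ε.εs + T * ε.εcs + 2 * ∑ j ∈ Finset.range n, linkProb n k ε j) := by
  have h : ∀ t, pathCost i k ε (inLayer n A t) = ∑ ℓ ∈ Finset.range (n + 1),
      if startTime ℓ ≤ t then pathCost i k ε (itemOps n A ℓ (t - startTime ℓ)) else 0 := by
    intro t
    rw [inLayer, pathCost_flatMap, sum_map_list_range]
    refine Finset.sum_congr rfl fun ℓ _ => ?_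
    split_ifs <;> rfl
  simp only [h]
  rw [Finset.sum_comm]
  refine (Finset.sum_le_card_nsmul _ _
    (2 * ε.εs + T * ε.εcs + 2 * ∑ j ∈ Finset.range n, linkProb n k ε j)
    fun ℓ hℓ => ?_).trans (le_of_eq ?_)
  · exact (sum_shift_le (fun s => pathCost_nonneg hε _) (startTime ℓ) T).trans
      (sum_pathCost_itemOps_le hε (Nat.lt_succ_iff.1 (Finset.mem_range.1 hℓ)) T)
  · rw [Finset.card_range, nsmul_eq_mul]
    push_cast
    rfl

/-- There are two halves, at most `2 n` items and at most `7 n` steps per half. This gives `2 · 2n ·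
2` for SWAPs and for links and `2 · 2n · 7n` for CSWAPs. Idling gives `14n · 6n`, from at most `6 n`
cells near the path, plus `2` for the two cells written. -/
theorem pathCost_operations_le (hn : 1 ≤ n) (hε : ε.Valid) (x : (Fin n → Bool) → Bool) :
    pathCost i k ε (operations n A x) ≤ 8 * n * ε.εs + 28 * n ^ 2 * ε.εcs
      + 8 * n * ∑ j ∈ Finset.range n, linkProb n k ε j + 86 * n ^ 2 * ε.εI := by
  have hlist : ∀ l : List (List (Gate n A)), pathCost i k ε (l.flatMap (withIdle n A))
      ≤ (l.map (pathCost i k ε)).sum + l.length * ((5 * n + 1) * ε.εI) := by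
    intro l
    induction l with
    | nil => simp [pathCost_nil]
    | cons L l ih =>
      rw [List.flatMap_cons, pathCost_append, List.map_cons, List.sum_cons, List.length_cons]
      push_cast
      linarith [pathCost_withIdle_le (A := A) (i := i) (k := k) hε L]
  have hin : ((inLayers n A).map (pathCost i k ε)).sum
      = ∑ t ∈ Finset.range (7 * n - 2), pathCost i k ε (inLayer n A t) := by
    rw [inLayers, List.map_map, sum_map_list_range]
    rfl
  have hlen : (layers n A x).length = 14 * n - 3 := by
    simp [layers, inLayers]
    omega
  have hlen' : ((14 * n - 3 : ℕ) : ℝ) ≤ 14 * n := by exact_mod_cast Nat.sub_le _ _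
  have hT : ((7 * n - 2 : ℕ) : ℝ) ≤ 7 * n := by exact_mod_cast Nat.sub_le _ _
  have hn' : (1 : ℝ) ≤ n := by exact_mod_cast hn
  have h := hlist (layers n A x)
  rw [hlen, layers, List.map_append, List.map_append, List.sum_append, List.sum_append,
    List.map_reverse, List.sum_reverse, hin, List.map_singleton, List.sum_singleton] at h
  have h₁ := sum_pathCost_inLayer_le (A := A) (i := i) (k := k) hε (7 * n - 2)
  have h₂ := pathCost_writeLayer_le (A := A) (i := i) (k := k) hε x
  set Q := ∑ j ∈ Finset.range n, linkProb n k ε j with hQ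
  have hQ0 : 0 ≤ Q := Finset.sum_nonneg fun j _ => faultProb_nonneg k hε _
  have hI := hε.1.1
  have hs := hε.2.2.1.1
  have hcs := hε.2.2.2.1
  have h₃ : ((14 * n - 3 : ℕ) : ℝ) * ((5 * n + 1) * ε.εI) ≤ 84 * n ^ 2 * ε.εI := by
    calc ((14 * n - 3 : ℕ) : ℝ) * ((5 * n + 1) * ε.εI) ≤ (14 * n) * ((6 * n) * ε.εI) := by
          gcongr
          linarith
      _ = _ := by ring
  have h₄ : ((n : ℝ) + 1) * (2 * ε.εs + (7 * n - 2 : ℕ) * ε.εcs + 2 * Q)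
      ≤ (2 * n) * (2 * ε.εs + 7 * n * ε.εcs + 2 * Q) := by
    gcongr
    linarith
  have h₅ : ε.εI ≤ n ^ 2 * ε.εI := le_mul_of_one_le_left hI (one_le_pow₀ hn')
  refine h.trans ?_
  nlinarith

end Cost

/-! ### The geometric series over the levels, and the final constants. -/

section Scaling

theorem sum_sqrt_two_pow_le (n k : ℕ) (hk : k ≤ n) :
    (∑ j ∈ Finset.range n, if k ≤ j + 1 then √(2 : ℝ) ^ (n - j) else 0) * √(2 : ℝ) ^ k
      ≤ 5 * √(2 : ℝ) ^ n := by
  have h2 : √(2 : ℝ) * √2 = 2 := Real.mul_self_sqrt (by norm_num)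
  have hr0 : 0 ≤ √(2 : ℝ) := Real.sqrt_nonneg 2
  have hr1 : (1.414 : ℝ) ≤ √2 := Real.le_sqrt_of_sq_le (by norm_num)
  have hr2 : √(2 : ℝ) ≤ 1.4143 := Real.sqrt_le_iff.2 ⟨by norm_num, by norm_num⟩
  set r := √(2 : ℝ) with hr
  -- The subtracted multiple `c` of `r ^ k` makes the induction close: the step needs `c ≥ r / (r -
  -- 1) ≈ 3.414`, the base case at `k - 1` needs `c ≤ 5 / r ≈ 3.535`.
  have key : ∀ m, k - 1 ≤ m →
      (∑ j ∈ Finset.range m, if k ≤ j + 1 then r ^ (m - j) else 0) * r ^ k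
        ≤ 5 * r ^ m - 3.5 * r ^ k := by
    intro m hm
    induction m, hm using Nat.le_induction with
    | base =>
      rw [Finset.sum_eq_zero, zero_mul]
      · cases k with
        | zero => norm_num
        | succ k =>
          rw [Nat.add_sub_cancel, pow_succ]
          have : 0 ≤ r ^ k := pow_nonneg hr0 k
          nlinarith
      · intro j hj
        rw [if_neg]
        have := Finset.mem_range.1 hj
        omega
    | succ m hm ih =>
      have hstep : ∑ j ∈ Finset.range m, (if k ≤ j + 1 then r ^ (m + 1 - j) else 0)
          = r * ∑ j ∈ Finset.range m, if k ≤ j + 1 then r ^ (m - j) else 0 := by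
        rw [Finset.mul_sum]
        refine Finset.sum_congr rfl fun j hj => ?_
        have := Finset.mem_range.1 hj
        split_ifs
        · rw [show m + 1 - j = (m - j) + 1 by omega, pow_succ, mul_comm]
        · rw [mul_zero]
      rw [Finset.sum_range_succ, hstep, if_pos (by omega), show m + 1 - m = 1 by omega, pow_one,
        pow_succ r m]
      have h₁ : 0 ≤ r ^ k := pow_nonneg hr0 k
      have h₂ := mul_le_mul_of_nonneg_left ih hr0
      nlinarith
  have := key n (by omega)
  have h₁ : 0 ≤ r ^ k := pow_nonneg hr0 k
  linarith

theorem one_sub_pow_le (p : ℝ) (h1 : p ≤ 1) (m : ℕ) : 1 - (1 - p) ^ m ≤ m * p := by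
  have := one_add_mul_le_pow (a := -p) (by linarith) m
  rw [← sub_eq_add_neg] at this
  linarith

/-- Bernoulli's inequality for the `3 m` GHZ qubits, with the floor in `m` removed by passing to
powers of `√2`. The condition is on `j + 1` because a link is labelled by the level of the child:
the link from level `k - 1` to `k` is noisy. -/
theorem linkProb_le {n k : ℕ} {ε : ErrorRates} (hε : ε.Valid) (j : ℕ) :
    linkProb n k ε j ≤ 3 * ε.εQ * if k ≤ j + 1 then √(2 : ℝ) ^ (n - j) else 0 := by
  rw [linkProb, faultProb]
  by_cases h : j + 1 < k
  · rw [if_pos h, if_neg (by omega), mul_zero]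
  · rw [if_neg h, if_pos (by omega)]
    refine (one_sub_pow_le _ hε.2.1.2 _).trans ?_
    have h₁ : (2 : ℝ) ^ ((n - j) / 2) ≤ √(2 : ℝ) ^ (n - j) := by
      calc (2 : ℝ) ^ ((n - j) / 2) = √(2 : ℝ) ^ (2 * ((n - j) / 2)) := by
            rw [pow_mul, Real.sq_sqrt (by norm_num)]
        _ ≤ √(2 : ℝ) ^ (n - j) :=
            pow_le_pow_right₀ (Real.one_le_sqrt.2 (by norm_num)) (by omega)
    push_cast
    have := mul_le_mul_of_nonneg_left h₁ (mul_nonneg zero_le_three hε.2.1.1)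
    linarith

theorem errorScale_two_pow (n k : ℕ) (ε : ErrorRates) :
    errorScale k ((2 : ℝ) ^ n) ε = n * (√(2 : ℝ) ^ n / √(2 : ℝ) ^ k) * ε.εQ + n * ε.εs
      + n ^ 2 * ε.εcs + n ^ 2 * ε.εI := by
  have hlog : Real.logb 2 ((2 : ℝ) ^ n) = n := by
    rw [Real.logb_pow, Real.logb_self_eq_one (by norm_num), mul_one]
  have hsqrt : √((2 : ℝ) ^ n) = √(2 : ℝ) ^ n := by
    rw [Real.sqrt_eq_iff_mul_self_eq (by positivity) (by positivity), ← mul_pow,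
      Real.mul_self_sqrt (by norm_num)]
  have hpow : (2 : ℝ) ^ (-(k : ℝ) / 2) = (√(2 : ℝ) ^ k)⁻¹ := by
    rw [neg_div, Real.rpow_neg (by norm_num), Real.sqrt_eq_rpow, ← Real.rpow_natCast,
      ← Real.rpow_mul (by norm_num)]
    congr 2
    ring
  rw [errorScale, hlog, hsqrt, hpow]
  ring

variable {n : ℕ} {A : Type} [CellModel A]

/-- The constant is `120 = 8 · 15`, where `15` is `3` CNOTs times the `5` of the geometric series;
it dominates the other coefficients `8`, `28` and `86`. -/
theorem pathCost_operations_le_errorScale {k : ℕ} (hn : 1 ≤ n) (hk : k ≤ n) {ε : ErrorRates}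
    (hε : ε.Valid) (x : (Fin n → Bool) → Bool) (i : Fin n → Bool) :
    pathCost i k ε (operations n A x) ≤ 120 * errorScale k ((2 : ℝ) ^ n) ε := by
  have hr : 0 < √(2 : ℝ) ^ k := by positivity
  have hsum : ∑ j ∈ Finset.range n, linkProb n k ε j
      ≤ 15 * (√(2 : ℝ) ^ n / √(2 : ℝ) ^ k) * ε.εQ := by
    refine (Finset.sum_le_sum fun j _ => linkProb_le hε j).trans ?_
    rw [← Finset.mul_sum]
    have h := (le_div_iff₀ hr).2 (sum_sqrt_two_pow_le n k hk)
    have := mul_le_mul_of_nonneg_left h (mul_nonneg zero_le_three hε.2.1.1)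
    refine this.trans (le_of_eq ?_)
    ring
  rw [errorScale_two_pow]
  have h := pathCost_operations_le (A := A) (i := i) (k := k) hn hε x
  have hn0 : (0 : ℝ) ≤ n := Nat.cast_nonneg n
  have h₁ := mul_le_mul_of_nonneg_left hsum (mul_nonneg (by norm_num : (0 : ℝ) ≤ 8) hn0)
  have h₂ : 0 ≤ n * ε.εs := mul_nonneg hn0 hε.2.2.1.1
  have h₃ : 0 ≤ n ^ 2 * ε.εcs := mul_nonneg (by positivity) hε.2.2.2.1
  have h₄ : 0 ≤ n ^ 2 * ε.εI := mul_nonneg (by positivity) hε.1.1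
  linarith

variable [LawfulCell A] [Fintype A] [DecidableEq A]

theorem infidelity_le_errorScale {k : ℕ} (hn : 1 ≤ n) (hk : k ≤ n) (x : (Fin n → Bool) → Bool)
    {ε : ErrorRates} (hε : ε.Valid) (E : FaultModel n A) (α : (Fin n → Bool) → ℂ)
    (hα : ∑ i, ‖α i‖ ^ 2 = 1) (hA : Waits A ∨ ∀ i j, α i ≠ 0 → α j ≠ 0 → i = j) :
    infidelity k x ε E α ≤ 480 * errorScale k ((2 : ℝ) ^ n) ε := by
  refine (infidelity_le_sum_touches hn k x ε (faultProb_nonneg k hε) (faultProb_le_one k hε) E α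
    hα hA).trans ?_
  have h : ∑ i, ‖α i‖ ^ 2 * pathCost i k ε (operations n A x)
      ≤ ∑ i, ‖α i‖ ^ 2 * (120 * errorScale k ((2 : ℝ) ^ n) ε) :=
    Finset.sum_le_sum fun i _ => mul_le_mul_of_nonneg_left
      (pathCost_operations_le_errorScale hn hk hε x i) (by positivity)
  rw [← Finset.sum_mul, hα] at h
  refine (mul_le_mul_of_nonneg_left h (by norm_num : (0 : ℝ) ≤ 4)).trans (le_of_eq ?_)
  ring

theorem infidelity_waiting_le {k : ℕ} (hn : 1 ≤ n) (hk : k ≤ n) (x : (Fin n → Bool) → Bool)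
    {ε : ErrorRates} (hε : ε.Valid) (E : FaultModel n (Option Bool)) (α : (Fin n → Bool) → ℂ)
    (hα : ∑ i, ‖α i‖ ^ 2 = 1) :
    infidelity k x ε E α ≤ 480 * errorScale k ((2 : ℝ) ^ n) ε :=
  infidelity_le_errorScale hn hk x hε E α hα (Or.inl ⟨rfl, rfl⟩)

theorem infidelity_single_le {k : ℕ} (hn : 1 ≤ n) (hk : k ≤ n) (x : (Fin n → Bool) → Bool)
    {ε : ErrorRates} (hε : ε.Valid) (E : FaultModel n Bool) (i : Fin n → Bool) :
    infidelity k x ε E (Pi.single i 1) ≤ 480 * errorScale k ((2 : ℝ) ^ n) ε := by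
  have h : ∀ j, (Pi.single i 1 : (Fin n → Bool) → ℂ) j ≠ 0 → j = i := fun j hj => by
    by_contra e
    exact hj (Pi.single_eq_of_ne e 1)
  refine infidelity_le_errorScale hn hk x hε E _ ?_
    (Or.inr fun j j' hj hj' => (h j hj).trans (h j' hj').symm)
  simp [Pi.single_apply, apply_ite]

/-- For `k = n` the factors `2 ^ (-k / 2)` and `√N` cancel, so each of the four terms is at most `n
^ 2 * δ`. -/
theorem errorScale_le_of_le (hn : 1 ≤ n) {ε : ErrorRates} {δ : ℝ} (hI : 0 ≤ ε.εI)
    (h₁ : ε.εQ ≤ δ) (h₂ : ε.εs ≤ δ) (h₃ : ε.εcs ≤ δ) (h₄ : ε.εI ≤ δ) :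
    errorScale n ((2 : ℝ) ^ n) ε ≤ 4 * Real.logb 2 ((2 : ℝ) ^ n) ^ 2 * δ := by
  have hlog : Real.logb 2 ((2 : ℝ) ^ n) = n := by
    rw [Real.logb_pow, Real.logb_self_eq_one (by norm_num), mul_one]
  have hn' : (1 : ℝ) ≤ n := by exact_mod_cast hn
  have hδ : 0 ≤ δ := hI.trans h₄
  have hsq : (n : ℝ) ≤ n ^ 2 := by nlinarith
  have hle : ∀ e, e ≤ δ → n * e ≤ (n : ℝ) ^ 2 * δ := fun e he =>
    (mul_le_mul_of_nonneg_left he (by linarith)).trans (mul_le_mul_of_nonneg_right hsq hδ)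
  have hle' : ∀ e, e ≤ δ → (n : ℝ) ^ 2 * e ≤ (n : ℝ) ^ 2 * δ := fun e he =>
    mul_le_mul_of_nonneg_left he (by positivity)
  rw [errorScale_two_pow, hlog, div_self (by positivity), mul_one]
  linarith [hle _ h₁, hle _ h₂, hle' _ h₃, hle' _ h₄]

end Scaling

end QRAM

end

theorem mainTheorem7 :
    (∃ C : ℝ, 0 < C ∧ ∀ n k : ℕ, 1 ≤ n → k ≤ n →
      ∀ (x : (Fin n → Bool) → Bool) (ε : QRAM.ErrorRates), ε.Valid →
        (∀ (E : QRAM.FaultModel n (Option Bool)) (α : (Fin n → Bool) → ℂ),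
          ∑ i, ‖α i‖ ^ 2 = 1 →
            QRAM.infidelity k x ε E α ≤ C * QRAM.errorScale k ((2 : ℝ) ^ n) ε) ∧
        (∀ (E : QRAM.FaultModel n Bool) (i : Fin n → Bool),
          QRAM.infidelity k x ε E (Pi.single i 1) ≤ C * QRAM.errorScale k ((2 : ℝ) ^ n) ε)) ∧
    (∃ C : ℝ, 0 < C ∧ ∀ n : ℕ, 1 ≤ n →
      ∀ (x : (Fin n → Bool) → Bool) (ε : QRAM.ErrorRates), ε.Valid →
        ∀ δ : ℝ, ε.εQ ≤ δ → ε.εs ≤ δ → ε.εcs ≤ δ → ε.εI ≤ δ →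
          (∀ (E : QRAM.FaultModel n (Option Bool)) (α : (Fin n → Bool) → ℂ),
            ∑ i, ‖α i‖ ^ 2 = 1 →
              QRAM.infidelity n x ε E α ≤ C * Real.logb 2 ((2 : ℝ) ^ n) ^ 2 * δ) ∧
          (∀ (E : QRAM.FaultModel n Bool) (i : Fin n → Bool),
            QRAM.infidelity n x ε E (Pi.single i 1)
              ≤ C * Real.logb 2 ((2 : ℝ) ^ n) ^ 2 * δ)) := by
  -- `480 = 4 · 120` combines the factor of `infidelity_kraus_le` with the path cost; `1920 = 4 ·
  -- 480` accounts for the four terms of the scale.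
  refine ⟨⟨480, by norm_num, fun n k hn hk x ε hε =>
      ⟨fun E α hα => QRAM.infidelity_waiting_le hn hk x hε E α hα,
        fun E i => QRAM.infidelity_single_le hn hk x hε E i⟩⟩,
    ⟨1920, by norm_num, fun n hn x ε hε δ h₁ h₂ h₃ h₄ => ?_⟩⟩
  have h : 480 * QRAM.errorScale n ((2 : ℝ) ^ n) ε
      ≤ 1920 * Real.logb 2 ((2 : ℝ) ^ n) ^ 2 * δ := by
    linarith [QRAM.errorScale_le_of_le hn hε.1.1 h₁ h₂ h₃ h₄]
  exact ⟨fun E α hα => (QRAM.infidelity_waiting_le hn le_rfl x hε E α hα).trans h,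
    fun E i => (QRAM.infidelity_single_le hn le_rfl x hε E i).trans h⟩
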